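/- **Setting.** Let $p\ge 1$, $B>0$, $C>0$, $r>0$, $\delta\in(0,1)$. Let $\theta^\star\in\mathbb R^p$ with $\|\theta^\star\|_2\le B$, and let $(\mathcal X_t)_{t\ge1}$ be deterministic decision sets contained in the closed Euclidean unit ball of $\mathbb R^p$. In round $t$ the agent plays $X_t\in\mathcal X_t$ and observes $Y_t=\langle\theta^\star,X_t\rangle+\varepsilon_t$. Put $\mathcal F_t=\sigma(\varepsilon_1,\dots,\varepsilon_t)$ ($\mathcal F_0$ trivial). The noise is algebraically mixing sub-Gaussian: every $\varepsilon_t$ is centred and $1$-sub-Gaussian, and with $\phi_d=Cd^{-r}$ ($\phi_0=\infty$), for all $d\ge0$ and $t>d$, almost surely $|\mathbb E[\varepsilon_t\mid\mathcal F_{t-d}]|\le\phi_d$ and $\mathbb E[\exp(\ell(\varepsilon_t-\mathbb E[\varepsilon_t\mid\mathcal F_{t-d}]))\mid\mathcal F_{t-d}]\le e^{\ell^2/2}$ for every $\ell\in\mathbb R$. **Algorithm (Mixing-LinUCB).** Let $\lambda=1/B^2$ and $d=\lceil C\,T^{1/(1+r)}\rceil$. Let $V_t=\sum_{s=1}^tX_sX_s^\top+\lambda\mathrm{Id}$,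 let $\widehat\theta_t$ be a minimiser of $\sum_{s=1}^t(\langle\theta,X_s\rangle-Y_s)^2$ over $\|\theta\|_2\le B$, and let $$\mathcal C_t=\Big\{\theta:\ \|\theta\|_2\le B,\ \tfrac12\|\theta-\widehat\theta_t\|_{V_t}^2\le\tfrac{dp}{2}\log\tfrac{(B+1)^2e\max(dp,t+d)}{dp}+2\lambda B^2+t\phi_d(B+1)+d\log\tfrac d\delta\Big\},$$ where $\|u\|_A=\sqrt{\langle u,Au\rangle}$. In rounds $t\le d$ the arm $X_t\in\mathcal X_t$ is arbitrary (not depending on the noise); in rounds $t>d$ the arm $X_t$ is a maximiser over $x\in\mathcal X_t$ of $\max_{\theta\in\mathcal C_{t-d}}\langle x,\theta\rangle$, chosen as an $\mathcal F_{t-d}$-measurable function. **Statement.** There is an absolute constant $K>0$ such that for all $p,B,C,r,\delta$ as above there is $T_0=T_0(p,B,C,r,\delta)$ such that for every $T\ge T_0$, every $\Delta>0$, and all $\theta^\star$, decision sets and noise as above for which, in every round $t\le T$, there is an optimal arm $X_t^\star\in\arg\max_{x\in\mathcal X_t}\langle x,\theta^\star\rangle$ with $\langle X_t^\star-x,\theta^\star\rangle\ge\Delta$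 for all $x\in\mathcal X_t\setminus\{X_t^\star\}$, the regret $\mathrm{Reg}(T)=\sum_{t=1}^T\sup_{x\in\mathcal X_t}\langle x-X_t,\theta^\star\rangle$ of Mixing-LinUCB satisfies, with probability at least $1-\delta$, $$\mathrm{Reg}(T)\le K\,\frac{Cp}{\Delta}\,T^{\frac2{1+r}}\log\!\Big(1+\frac{B^2T}{pC\,T^{1/(1+r)}}\Big)\Big(\frac p2\log\frac{(B+1)^2eT}{p}+\log\frac{C\,T^{1/(1+r)}}{\delta}\Big).$$ -/

import Mathlib

open MeasureTheory ProbabilityTheory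
open scoped ENNReal NNReal RealInnerProductSpace

noncomputable section

namespace MixingBandit

/-- The sigma-algebra `F t` generated by the noise variables `ε 1, …, ε t`; `F 0` is trivial. -/
abbrev noiseSigma {Ω : Type*} (ε : ℕ → Ω → ℝ) (t : ℕ) : MeasurableSpace Ω :=
  ⨆ s ∈ Finset.Icc 1 t, MeasurableSpace.comap (ε s) inferInstance

/-- `(σ, φ)`-mixing sub-Gaussian noise `(ε t)`, `t ≥ 1`. The mixing coefficients take values in
`[0, ∞]`, so that `φ 0 = ∞` is allowed (for `d = 0` the bound reads `|ε t| ≤ φ 0`). -/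
structure IsMixingSubgaussian {Ω : Type*} [MeasurableSpace Ω] (μ : Measure Ω)
    (σ : ℝ≥0) (φ : ℕ → ℝ≥0∞) (ε : ℕ → Ω → ℝ) : Prop where
  antitone : Antitone φ
  measurable : ∀ t, 1 ≤ t → Measurable (ε t)
  centred : ∀ t, 1 ≤ t → ∫ ω, ε t ω ∂μ = 0
  subgaussian : ∀ t, 1 ≤ t → HasSubgaussianMGF (ε t) (σ ^ 2) μ
  mixing : ∀ d t : ℕ, d < t →
    ∀ᵐ ω ∂μ, ‖(μ[ε t | noiseSigma ε (t - d)]) ω‖ₑ ≤ φ d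
  cond_subgaussian : ∀ d t : ℕ, d < t → ∀ l : ℝ,
    ∀ᵐ ω ∂μ,
      (μ[fun ω' => Real.exp (l * (ε t ω' - (μ[ε t | noiseSigma ε (t - d)]) ω')) |
        noiseSigma ε (t - d)]) ω ≤ Real.exp (l ^ 2 * (σ : ℝ) ^ 2 / 2)

/-- Algebraic mixing coefficients `φ d = C d ^ (-r)`, with the value `∞` at `d = 0`. -/
def algebraicRate (C r : ℝ) (d : ℕ) : ℝ≥0∞ :=
  ENNReal.ofReal C * (d : ℝ≥0∞) ^ (-r)

/-- The reward `Y t = ⟨θ⋆, X t⟩ + ε t`. -/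
def reward {p : ℕ} {Ω : Type*} (θstar : EuclideanSpace ℝ (Fin p)) (ε : ℕ → Ω → ℝ)
    (X : ℕ → Ω → EuclideanSpace ℝ (Fin p)) (t : ℕ) (ω : Ω) : ℝ :=
  ⟪θstar, X t ω⟫ + ε t ω

/-- The regularised feature-covariance matrix `V t = ∑ s ≤ t, X s (X s)ᵀ + lam Id`. -/
def featureCov {p : ℕ} (lam : ℝ) (X : ℕ → EuclideanSpace ℝ (Fin p)) (t : ℕ) :
    Matrix (Fin p) (Fin p) ℝ :=
  (∑ s ∈ Finset.Icc 1 t, Matrix.vecMulVec (X s).ofLp (X s).ofLp) + lam • 1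

/-- The (semi-)norm `‖u‖_A = √⟨u, A u⟩`. -/
def weightedNorm {p : ℕ} (A : Matrix (Fin p) (Fin p) ℝ) (u : EuclideanSpace ℝ (Fin p)) : ℝ :=
  √(u.ofLp ⬝ᵥ (A.mulVec u.ofLp))

/-- `θhat` is a minimiser of the squared loss of the first `t` rounds over the ball of radius
`B`. -/
def IsLeastSquares {p : ℕ} (B : ℝ) (X : ℕ → EuclideanSpace ℝ (Fin p)) (Y : ℕ → ℝ) (t : ℕ)
    (θhat : EuclideanSpace ℝ (Fin p)) : Prop :=
  θhat ∈ Metric.closedBall (0 : EuclideanSpace ℝ (Fin p)) B ∧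
    IsMinOn (fun θ => ∑ s ∈ Finset.Icc 1 t, (⟪θ, X s⟫ - Y s) ^ 2)
      (Metric.closedBall (0 : EuclideanSpace ℝ (Fin p)) B) θhat

/-- The confidence set after `t` rounds, for delay `d`, regularisation `lam`, confidence level
`1 - δ`, and value `φd` of the mixing coefficient at `d`. -/
def confidenceSet {p : ℕ} (B lam δ φd : ℝ) (d : ℕ) (X : ℕ → EuclideanSpace ℝ (Fin p))
    (θhat : EuclideanSpace ℝ (Fin p)) (t : ℕ) : Set (EuclideanSpace ℝ (Fin p)) :=
  {θ | θ ∈ Metric.closedBall (0 : EuclideanSpace ℝ (Fin p)) B ∧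
    (1 / 2 : ℝ) * weightedNorm (featureCov lam X t) (θ - θhat) ^ 2 ≤
      ((d : ℝ) * p / 2) *
          Real.log ((B + 1) ^ 2 * Real.exp 1 * max ((d : ℝ) * p) ((t : ℝ) + d) / ((d : ℝ) * p))
        + 2 * lam * B ^ 2 + (t : ℝ) * φd * (B + 1) + (d : ℝ) * Real.log ((d : ℝ) / δ)}

/-- The upper confidence bound `max θ ∈ S, ⟨x, θ⟩` of the arm `x`. -/
def ucb {p : ℕ} (S : Set (EuclideanSpace ℝ (Fin p))) (x : EuclideanSpace ℝ (Fin p)) : ℝ :=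
  sSup ((fun θ => ⟪x, θ⟫) '' S)

/-- `X` is the sequence of arms played by Mixing-LinUCB with delay `d`, on the decision sets `𝒳`
and with rewards `⟨θ⋆, X t⟩ + ε t`; `θhat t` is the least-squares estimator after `t` rounds.
The algorithm is not randomised and uses at round `t` only the first `t - d` rewards, so `X t` is
`F (t - d)`-measurable; in particular the arms of the first `d` rounds are arbitrary but do not
depend on the noise (`t - d = 0` there, and `F 0` is trivial). -/
structure IsMixingLinUCB {p : ℕ} {Ω : Type*} (B lam δ : ℝ) (φ : ℕ → ℝ≥0∞) (d : ℕ)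
    (𝒳 : ℕ → Set (EuclideanSpace ℝ (Fin p))) (θstar : EuclideanSpace ℝ (Fin p))
    (ε : ℕ → Ω → ℝ) (X θhat : ℕ → Ω → EuclideanSpace ℝ (Fin p)) : Prop where
  mem : ∀ t, 1 ≤ t → ∀ ω, X t ω ∈ 𝒳 t
  measurable : ∀ t, 1 ≤ t → Measurable[noiseSigma ε (t - d)] (X t)
  leastSquares : ∀ t, 1 ≤ t → ∀ ω,
    IsLeastSquares B (fun s => X s ω) (fun s => reward θstar ε X s ω) t (θhat t ω)
  optimistic : ∀ t, d < t → ∀ ω,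
    IsMaxOn
      (ucb (confidenceSet B lam δ (φ d).toReal d (fun s => X s ω) (θhat (t - d) ω) (t - d)))
      (𝒳 t) (X t ω)

/-- The regret after `T` rounds. -/
def regret {p : ℕ} {Ω : Type*} (𝒳 : ℕ → Set (EuclideanSpace ℝ (Fin p)))
    (θstar : EuclideanSpace ℝ (Fin p)) (X : ℕ → Ω → EuclideanSpace ℝ (Fin p))
    (T : ℕ) (ω : Ω) : ℝ :=
  ∑ t ∈ Finset.Icc 1 T, ⨆ x : 𝒳 t, (⟪(x : EuclideanSpace ℝ (Fin p)), θstar⟫ - ⟪X t ω, θstar⟫)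

/-- In each of the first `T` rounds `xstar t` is an optimal arm, and the expected reward of every
other arm is smaller by at least `Δ`: the minimum gap is at least `Δ`. -/
def HasGap {p : ℕ} (𝒳 : ℕ → Set (EuclideanSpace ℝ (Fin p)))
    (θstar : EuclideanSpace ℝ (Fin p)) (xstar : ℕ → EuclideanSpace ℝ (Fin p))
    (T : ℕ) (Δ : ℝ) : Prop :=
  ∀ t ∈ Finset.Icc 1 T, xstar t ∈ 𝒳 t ∧ IsMaxOn (fun x => ⟪x, θstar⟫) (𝒳 t) (xstar t) ∧
    ∀ x ∈ 𝒳 t, x ≠ xstar t → Δ ≤ ⟪xstar t - x, θstar⟫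

end MixingBandit

end

/-! Split the rounds into the `d` residue classes modulo `d`. Within one class, the innovation `ε s
- E[ε s | F (s - d)]` is conditionally sub-Gaussian given a sigma-algebra that contains all earlier
innovations of the class and makes `X s` measurable. Hence the likelihood ratio of any fixed `θ`
against `θstar`, and its average over the ball of radius `B + 1`, is a nonnegative supermartingale.
The average is at least the likelihood ratio of any single `‖θ‖ ≤ B`, up to a localisation price, so
one supermartingale per class controls all `θ` and all rounds at once.

By Ville's inequality, the logarithm of the running maximum in each class is dominated by a variable
of mean at most `2`. Summing over the classes and applying Markov's inequality costs `2 d / δ`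
(`exists_event_sum_le`). For `φ = algebraicRate C r`, `T φ d` is of order `d`, so this cost and the
bias `2 B T φ d` both fit into `d log (d / δ)` for large `T`. Hence `θstar` lies in every confidence
set (`mem_confidenceSet_of_sum_le`).

A gap gives `g ≤ g ^ 2 / Δ` for the instantaneous regret `g`. The potential matrix uses all rounds
before the current one, although the confidence set lags behind; the missing rounds cost `O(B ^ 2)`
each. The delay thus enters additively (`regret_le_of_optimistic`): the regret is of order `T ^ (1 /
(1 + r)) (log T) ^ 2 / Δ`, with constants depending on the parameters. The claimed bound has `T ^ (2
/ (1 + r))`; the spare power of `T` absorbs all constants and logarithms, and `K = 1` suffices. -/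

namespace MixingBandit

/-! ### Exponential supermartingales and maximal inequalities. -/

section Supermartingale

variable {Ω : Type*}

lemma setLIntegral_exp_const_le {m m0 : MeasurableSpace Ω} (hm : m ≤ m0) {μ : Measure Ω}
    [IsProbabilityMeasure μ] {ξ : Ω → ℝ} {l : ℝ}
    (hint : Integrable (fun ω => Real.exp (l * ξ ω)) μ)
    (hle : ∀ᵐ ω ∂μ, (μ[fun ω => Real.exp (l * ξ ω) | m]) ω ≤ Real.exp (l ^ 2 / 2))
    {A : Set Ω} (hA : MeasurableSet[m] A) :
    ∫⁻ ω in A, ENNReal.ofReal (Real.exp (l * ξ ω - l ^ 2 / 2)) ∂μ ≤ μ A := by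
  have h1 : ∫ ω in A, Real.exp (l * ξ ω) ∂μ ≤ Real.exp (l ^ 2 / 2) * μ.real A := by
    rw [← setIntegral_condExp hm hint hA]
    calc ∫ ω in A, (μ[fun ω => Real.exp (l * ξ ω) | m]) ω ∂μ
        ≤ ∫ _ in A, Real.exp (l ^ 2 / 2) ∂μ :=
          integral_mono_ae integrable_condExp.integrableOn (integrable_const _)
            (ae_restrict_of_ae hle)
      _ = _ := by simp [mul_comm]
  have h2 : ∫ ω in A, Real.exp (l * ξ ω - l ^ 2 / 2) ∂μ ≤ μ.real A := by
    have : ∀ ω, Real.exp (l * ξ ω - l ^ 2 / 2) = Real.exp (l * ξ ω) * Real.exp (-(l ^ 2 / 2)) :=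
      fun ω => by rw [← Real.exp_add, sub_eq_add_neg]
    simp_rw [this, integral_mul_const]
    calc _ ≤ Real.exp (l ^ 2 / 2) * μ.real A * Real.exp (-(l ^ 2 / 2)) := by gcongr
      _ = μ.real A := by
        rw [mul_right_comm, ← Real.exp_add, add_neg_cancel, Real.exp_zero, one_mul]
  have hint' : Integrable (fun ω => Real.exp (l * ξ ω - l ^ 2 / 2)) (μ.restrict A) := by
    have : (fun ω => Real.exp (l * ξ ω - l ^ 2 / 2)) =
        fun ω => Real.exp (l * ξ ω) * Real.exp (-(l ^ 2 / 2)) := by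
      ext ω; rw [← Real.exp_add, sub_eq_add_neg]
    rw [this]
    exact (hint.mul_const _).integrableOn
  rw [← ofReal_integral_eq_lintegral_ofReal hint' (ae_of_all _ fun _ => (Real.exp_pos _).le)]
  exact (ENNReal.ofReal_le_ofReal h2).trans (by simp)

/-- The conditional bound holds almost surely for each fixed `l`, with an exceptional set depending
on `l`, so a random tilt cannot simply be substituted. For a tilt with finitely many values, split
`A` along its level sets; the general case follows by simple approximation and Fatou's lemma. -/
lemma setLIntegral_exp_le {m m0 : MeasurableSpace Ω} (hm : m ≤ m0) {μ : Measure Ω}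
    [IsProbabilityMeasure μ] {ξ : Ω → ℝ} (hξ : Measurable ξ)
    (hint : ∀ l : ℝ, Integrable (fun ω => Real.exp (l * ξ ω)) μ)
    (hle : ∀ l : ℝ, ∀ᵐ ω ∂μ, (μ[fun ω => Real.exp (l * ξ ω) | m]) ω ≤ Real.exp (l ^ 2 / 2))
    {L : Ω → ℝ} (hL : Measurable[m] L) {A : Set Ω} (hA : MeasurableSet[m] A) :
    ∫⁻ ω in A, ENNReal.ofReal (Real.exp (L ω * ξ ω - L ω ^ 2 / 2)) ∂μ ≤ μ A := by
  have hsimple : ∀ S : Ω → ℝ, Measurable[m] S → (Set.range S).Finite →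
      ∫⁻ ω in A, ENNReal.ofReal (Real.exp (S ω * ξ ω - S ω ^ 2 / 2)) ∂μ ≤ μ A := by
    intro S hSm hfin
    have hS : ∀ l, MeasurableSet[m] (S ⁻¹' {l}) := fun l => hSm (measurableSet_singleton l)
    have hU : A = ⋃ l ∈ hfin.toFinset, A ∩ S ⁻¹' {l} := by
      ext ω; simp
    have hd : Set.PairwiseDisjoint (hfin.toFinset : Set ℝ) fun l => A ∩ S ⁻¹' {l} := by
      intro l _ l' _ hll'
      refine Set.disjoint_left.2 fun ω h h' => hll' ?_
      rw [← h.2, ← h'.2]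
    have hM : ∀ l ∈ hfin.toFinset, MeasurableSet (A ∩ S ⁻¹' {l}) := fun l _ => hm _ (hA.inter (hS l))
    conv_lhs => rw [hU]
    rw [lintegral_biUnion_finset hd hM]
    conv_rhs => rw [hU, measure_biUnion_finset hd hM]
    refine Finset.sum_le_sum fun l _ => ?_
    refine le_trans (le_of_eq ?_) (setLIntegral_exp_const_le hm (hint l) (hle l) (hA.inter (hS l)))
    refine setLIntegral_congr_fun (hm _ (hA.inter (hS l))) fun ω hω => ?_
    have : S ω = l := hω.2
    simp only [this]
  have hsm : StronglyMeasurable[m] L := hL.stronglyMeasurable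
  have hlim : ∀ ω, Filter.Tendsto
      (fun n => ENNReal.ofReal (Real.exp (hsm.approx n ω * ξ ω - hsm.approx n ω ^ 2 / 2)))
      Filter.atTop (nhds (ENNReal.ofReal (Real.exp (L ω * ξ ω - L ω ^ 2 / 2)))) := by
    intro ω
    have hc : Continuous fun y : ℝ => ENNReal.ofReal (Real.exp (y * ξ ω - y ^ 2 / 2)) :=
      ENNReal.continuous_ofReal.comp (by fun_prop)
    exact (hc.tendsto _).comp (hsm.tendsto_approx ω)
  calc ∫⁻ ω in A, ENNReal.ofReal (Real.exp (L ω * ξ ω - L ω ^ 2 / 2)) ∂μ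
      = ∫⁻ ω in A, Filter.liminf (fun n => ENNReal.ofReal
          (Real.exp (hsm.approx n ω * ξ ω - hsm.approx n ω ^ 2 / 2))) Filter.atTop ∂μ :=
        lintegral_congr fun ω => (hlim ω).liminf_eq.symm
    _ ≤ Filter.liminf (fun n => ∫⁻ ω in A, ENNReal.ofReal
          (Real.exp (hsm.approx n ω * ξ ω - hsm.approx n ω ^ 2 / 2)) ∂μ) Filter.atTop := by
        refine lintegral_liminf_le fun n => ?_
        have : Measurable (hsm.approx n) := (@SimpleFunc.measurable _ _ m _ (hsm.approx n)).mono hm le_rfl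
        fun_prop
    _ ≤ μ A := by
        refine Filter.liminf_le_of_frequently_le' (Filter.Frequently.of_forall fun n =>
          hsimple _ (@SimpleFunc.measurable _ _ m _ (hsm.approx n))
            (@SimpleFunc.finite_range _ _ m (hsm.approx n)))

/-- Multiplying by a conditionally sub-Gaussian exponential weight with predictable tilt does not
increase the expectation of a predictable nonnegative variable. -/
lemma lintegral_mul_exp_le {m m0 : MeasurableSpace Ω} (hm : m ≤ m0) {μ : Measure Ω}
    [IsProbabilityMeasure μ] {ξ : Ω → ℝ} (hξ : Measurable ξ)
    (hint : ∀ l : ℝ, Integrable (fun ω => Real.exp (l * ξ ω)) μ)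
    (hle : ∀ l : ℝ, ∀ᵐ ω ∂μ, (μ[fun ω => Real.exp (l * ξ ω) | m]) ω ≤ Real.exp (l ^ 2 / 2))
    {L : Ω → ℝ} (hL : Measurable[m] L) {Z : Ω → ℝ≥0∞} (hZ : Measurable[m] Z) :
    ∫⁻ ω, Z ω * ENNReal.ofReal (Real.exp (L ω * ξ ω - L ω ^ 2 / 2)) ∂μ ≤ ∫⁻ ω, Z ω ∂μ := by
  have hLm : Measurable L := hL.mono hm le_rfl
  set h : Ω → ℝ≥0∞ := fun ω => ENNReal.ofReal (Real.exp (L ω * ξ ω - L ω ^ 2 / 2)) with hh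
  have hmeas : Measurable h := by fun_prop
  -- The bound on all `m`-measurable sets is a domination of measures on `m`, which passes to any
  -- `Z` with values in `[0, ∞]` without integrability conditions.
  have hle' : (μ.withDensity h).trim hm ≤ μ.trim hm := by
    refine Measure.le_iff.2 fun A hA => ?_
    rw [trim_measurableSet_eq hm hA, trim_measurableSet_eq hm hA, withDensity_apply _ (hm _ hA)]
    exact setLIntegral_exp_le hm hξ hint hle hL hA
  calc ∫⁻ ω, Z ω * h ω ∂μ = ∫⁻ ω, Z ω ∂(μ.withDensity h) := by
        rw [lintegral_withDensity_eq_lintegral_mul _ hmeas (hZ.mono hm le_rfl)]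
        simp [mul_comm]
    _ = ∫⁻ ω, Z ω ∂((μ.withDensity h).trim hm) := (lintegral_trim hm hZ).symm
    _ ≤ ∫⁻ ω, Z ω ∂(μ.trim hm) := lintegral_mono' hle' le_rfl
    _ = ∫⁻ ω, Z ω ∂μ := lintegral_trim hm hZ

/-- Ville's maximal inequality for nonnegative supermartingales with values in `[0, ∞]`. -/
lemma mul_measure_exists_le_le_lintegral {m0 : MeasurableSpace Ω} {μ : Measure Ω}
    {G : ℕ → MeasurableSpace Ω} (hG : ∀ k, G k ≤ m0) (hmono : Monotone G)
    {M : ℕ → Ω → ℝ≥0∞} (hM : ∀ k, Measurable[G k] (M k))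
    (hsuper : ∀ k A, MeasurableSet[G k] A → ∫⁻ ω in A, M (k + 1) ω ∂μ ≤ ∫⁻ ω in A, M k ω ∂μ)
    (x : ℝ≥0∞) (n : ℕ) :
    x * μ {ω | ∃ k ≤ n, x ≤ M k ω} ≤ ∫⁻ ω, M 0 ω ∂μ := by
  have hset : ∀ k, MeasurableSet[G k] {ω | x ≤ M k ω} := fun k => hM k measurableSet_Ici
  have hhit : ∀ n, MeasurableSet[G n] {ω | ∃ k ≤ n, x ≤ M k ω} := by
    intro n
    have : {ω | ∃ k ≤ n, x ≤ M k ω} = ⋃ k ∈ Finset.range (n + 1), {ω | x ≤ M k ω} := by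
      ext ω; simp
    rw [this]
    exact Finset.measurableSet_biUnion _ fun k hk =>
      hmono (Nat.lt_succ_iff.1 (Finset.mem_range.1 hk)) _ (hset k)
  have key : ∀ B : Set Ω, MeasurableSet B → ∀ k,
      x * μ (B ∩ {ω | x ≤ M k ω}) + ∫⁻ ω in B ∩ {ω | x ≤ M k ω}ᶜ, M k ω ∂μ
        ≤ ∫⁻ ω in B, M k ω ∂μ := by
    intro B hB k
    rw [← lintegral_inter_add_sdiff (M k) B (hG k _ (hset k)), Set.sdiff_eq]
    gcongr
    rw [← setLIntegral_const]
    exact setLIntegral_mono' (hB.inter (hG k _ (hset k))) fun ω hω => hω.2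
  -- The induction carries the mass of `M n` off the hitting event, which replaces stopping at the
  -- first hitting time.
  have main : ∀ n, x * μ {ω | ∃ k ≤ n, x ≤ M k ω} +
      ∫⁻ ω in {ω | ∃ k ≤ n, x ≤ M k ω}ᶜ, M n ω ∂μ ≤ ∫⁻ ω, M 0 ω ∂μ := by
    intro n
    induction n with
    | zero => simpa using key Set.univ MeasurableSet.univ 0
    | succ n ih =>
      set H := {ω | ∃ k ≤ n, x ≤ M k ω} with hH
      have hHm : MeasurableSet H := hG n _ (hhit n)
      have hsucc : {ω | ∃ k ≤ n + 1, x ≤ M k ω} = H ∪ (Hᶜ ∩ {ω | x ≤ M (n + 1) ω}) := by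
        ext ω
        simp only [hH, Set.mem_ofPred_eq, Set.mem_union, Set.mem_inter_iff, Set.mem_compl_iff]
        constructor
        · rintro ⟨k, hk, hx⟩
          by_cases h : ∃ k ≤ n, x ≤ M k ω
          · exact Or.inl h
          · rcases Nat.le_succ_iff.1 hk with hk | rfl
            · exact absurd ⟨k, hk, hx⟩ h
            · exact Or.inr ⟨h, hx⟩
        · rintro (⟨k, hk, hx⟩ | ⟨_, hx⟩)
          · exact ⟨k, hk.trans n.le_succ, hx⟩
          · exact ⟨n + 1, le_rfl, hx⟩
      have hcompl : {ω | ∃ k ≤ n + 1, x ≤ M k ω}ᶜ = Hᶜ ∩ {ω | x ≤ M (n + 1) ω}ᶜ := by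
        rw [hsucc]; ext ω; simp; tauto
      rw [hcompl, hsucc]
      calc _ ≤ x * (μ H + μ (Hᶜ ∩ {ω | x ≤ M (n + 1) ω})) +
              ∫⁻ ω in Hᶜ ∩ {ω | x ≤ M (n + 1) ω}ᶜ, M (n + 1) ω ∂μ := by
            gcongr; exact measure_union_le _ _
        _ = x * μ H + (x * μ (Hᶜ ∩ {ω | x ≤ M (n + 1) ω}) +
              ∫⁻ ω in Hᶜ ∩ {ω | x ≤ M (n + 1) ω}ᶜ, M (n + 1) ω ∂μ) := by ring
        _ ≤ x * μ H + ∫⁻ ω in Hᶜ, M (n + 1) ω ∂μ := by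
            gcongr; exact key _ hHm.compl (n + 1)
        _ ≤ x * μ H + ∫⁻ ω in Hᶜ, M n ω ∂μ := by
            exact add_le_add le_rfl (hsuper n _ (hhit n).compl)
        _ ≤ _ := ih
  exact le_self_add.trans (main n)

/-- The logarithm of the running maximum of a nonnegative supermartingale started at most at one
is dominated by a random variable with expectation at most two. -/
lemma exists_lintegral_le_two_of_supermartingale {m0 : MeasurableSpace Ω} {μ : Measure Ω}
    {G : ℕ → MeasurableSpace Ω} (hG : ∀ k, G k ≤ m0) (hmono : Monotone G)
    {M : ℕ → Ω → ℝ≥0∞} (hM : ∀ k, Measurable[G k] (M k))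
    (hsuper : ∀ k A, MeasurableSet[G k] A → ∫⁻ ω in A, M (k + 1) ω ∂μ ≤ ∫⁻ ω in A, M k ω ∂μ)
    (hone : ∫⁻ ω, M 0 ω ∂μ ≤ 1) (n : ℕ) :
    ∃ N : Ω → ℝ≥0∞, Measurable N ∧ ∫⁻ ω, N ω ∂μ ≤ 2 ∧
      ∀ ω, ∀ k ≤ n, ∀ a : ℝ, ENNReal.ofReal (Real.exp a) ≤ M k ω → ENNReal.ofReal a ≤ N ω := by
  set A : ℕ → Set Ω := fun j => {ω | ∃ k ≤ n, (2 : ℝ≥0∞) ^ j ≤ M k ω} with hAdef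
  have hA : ∀ j, MeasurableSet (A j) := by
    intro j
    have : A j = ⋃ k ∈ Finset.range (n + 1), {ω | (2 : ℝ≥0∞) ^ j ≤ M k ω} := by
      ext ω; simp [hAdef]
    rw [this]
    exact Finset.measurableSet_biUnion _ fun k _ => hG k _ (hM k measurableSet_Ici)
  -- The witness counts the dyadic levels `2 ^ j` reached by the running maximum; level `j` is
  -- reached with probability at most `2 ^ (-j)`.
  refine ⟨fun ω => ∑' j, (A j).indicator 1 ω,
    Measurable.tsum fun j => measurable_one.indicator (hA j), ?_, ?_⟩
  · rw [lintegral_tsum fun j => (measurable_one.indicator (hA j)).aemeasurable]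
    calc ∑' j, ∫⁻ ω, (A j).indicator 1 ω ∂μ ≤ ∑' j : ℕ, (2⁻¹ : ℝ≥0∞) ^ j := by
          refine ENNReal.tsum_le_tsum fun j => ?_
          rw [lintegral_indicator_one (hA j)]
          have h := (mul_measure_exists_le_le_lintegral hG hmono hM hsuper (2 ^ j) n).trans hone
          rw [← ENNReal.inv_pow]
          rw [mul_comm] at h
          exact ENNReal.le_inv_iff_mul_le.2 h
      _ = 2 := by rw [ENNReal.tsum_geometric, ENNReal.one_sub_inv_two, inv_inv]
  · intro ω k hk a ha
    rcases lt_or_ge a 0 with h0 | h0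
    · simp [ENNReal.ofReal_of_nonpos h0.le]
    -- Since `2 ≤ e`, a value at least `exp a` reaches every level `j ≤ a`, that is, `⌊a⌋₊ + 1 ≥ a`
    -- levels.
    have hmem : ∀ j ∈ Finset.range (⌊a⌋₊ + 1), (A j).indicator (1 : Ω → ℝ≥0∞) ω = 1 := by
      intro j hj
      refine Set.indicator_of_mem ?_ _
      refine ⟨k, hk, le_trans ?_ ha⟩
      have hja : (j : ℝ) ≤ a :=
        (Nat.cast_le.2 (Nat.lt_succ_iff.1 (Finset.mem_range.1 hj))).trans (Nat.floor_le h0)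
      have h2 : (2 : ℝ) ^ j ≤ Real.exp a := by
        calc (2 : ℝ) ^ j ≤ Real.exp 1 ^ j := by
              gcongr; linarith [Real.add_one_le_exp (1 : ℝ)]
          _ = Real.exp j := by rw [← Real.exp_nat_mul, mul_one]
          _ ≤ _ := Real.exp_le_exp.2 hja
      calc (2 : ℝ≥0∞) ^ j = ENNReal.ofReal (2 ^ j) := by
            rw [ENNReal.ofReal_pow (by norm_num)]; simp
        _ ≤ _ := ENNReal.ofReal_le_ofReal h2
    calc ENNReal.ofReal a ≤ ((⌊a⌋₊ + 1 : ℕ) : ℝ≥0∞) := by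
          rw [← ENNReal.ofReal_natCast]
          exact ENNReal.ofReal_le_ofReal (by push_cast; exact (Nat.lt_floor_add_one a).le)
      _ = ∑ j ∈ Finset.range (⌊a⌋₊ + 1), (A j).indicator (1 : Ω → ℝ≥0∞) ω := by
          rw [Finset.sum_congr rfl hmem]; simp
      _ ≤ _ := ENNReal.sum_le_tsum _

end Supermartingale

end MixingBandit

noncomputable section

namespace MixingBandit

/-! ### Mixtures of likelihood ratios over a ball. -/

section Mixture

variable {p : ℕ}

/-- The log-likelihood ratio of the parameters `θ` and `θ₀` after `k` observations with features
`x` and noise `ξ`. -/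
def logWeight (θ₀ : EuclideanSpace ℝ (Fin p)) (x : ℕ → EuclideanSpace ℝ (Fin p)) (ξ : ℕ → ℝ)
    (k : ℕ) (θ : EuclideanSpace ℝ (Fin p)) : ℝ :=
  ∑ j ∈ Finset.range k, (⟪θ - θ₀, x j⟫ * ξ j - ⟪θ - θ₀, x j⟫ ^ 2 / 2)

/-- The likelihood ratio mixed over the uniform distribution on the ball of radius `R`. -/
def mixedWeight (R : ℝ) (θ₀ : EuclideanSpace ℝ (Fin p)) (x : ℕ → EuclideanSpace ℝ (Fin p))
    (ξ : ℕ → ℝ) (k : ℕ) : ℝ≥0∞ :=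
  (volume (Metric.closedBall (0 : EuclideanSpace ℝ (Fin p)) R))⁻¹ *
    ∫⁻ θ in Metric.closedBall (0 : EuclideanSpace ℝ (Fin p)) R,
      ENNReal.ofReal (Real.exp (logWeight θ₀ x ξ k θ))

lemma measurable_logWeight {Ω : Type*} [MeasurableSpace Ω] (θ₀ : EuclideanSpace ℝ (Fin p))
    {x : ℕ → Ω → EuclideanSpace ℝ (Fin p)} {ξ : ℕ → Ω → ℝ} {k : ℕ}
    (hx : ∀ j < k, Measurable (x j)) (hξ : ∀ j < k, Measurable (ξ j)) :
    Measurable fun z : Ω × EuclideanSpace ℝ (Fin p) =>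
      logWeight θ₀ (fun j => x j z.1) (fun j => ξ j z.1) k z.2 := by
  unfold logWeight
  refine Finset.measurable_sum _ fun j hj => ?_
  have h1 := hx j (Finset.mem_range.1 hj)
  have h2 := hξ j (Finset.mem_range.1 hj)
  have h3 : Measurable fun z : Ω × EuclideanSpace ℝ (Fin p) => ⟪z.2 - θ₀, x j z.1⟫ :=
    Measurable.inner (measurable_snd.sub_const θ₀) (h1.comp measurable_fst)
  exact (h3.mul (h2.comp measurable_fst)).sub ((h3.pow_const 2).div_const 2)

lemma measurable_const_inner {Ω : Type*} [MeasurableSpace Ω] (u : EuclideanSpace ℝ (Fin p))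
    {x : Ω → EuclideanSpace ℝ (Fin p)} (hx : Measurable x) : Measurable fun ω => ⟪u, x ω⟫ :=
  Measurable.inner measurable_const hx

lemma measurable_logWeight_left {Ω : Type*} [MeasurableSpace Ω] (θ₀ θ : EuclideanSpace ℝ (Fin p))
    {x : ℕ → Ω → EuclideanSpace ℝ (Fin p)} {ξ : ℕ → Ω → ℝ} {k : ℕ}
    (hx : ∀ j < k, Measurable (x j)) (hξ : ∀ j < k, Measurable (ξ j)) :
    Measurable fun ω => logWeight θ₀ (fun j => x j ω) (fun j => ξ j ω) k θ := by
  unfold logWeight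
  refine Finset.measurable_sum _ fun j hj => ?_
  have h1 := measurable_const_inner (θ - θ₀) (hx j (Finset.mem_range.1 hj))
  exact (h1.mul (hξ j (Finset.mem_range.1 hj))).sub ((h1.pow_const 2).div_const 2)

lemma measurable_mixedWeight {Ω : Type*} [MeasurableSpace Ω] (R : ℝ)
    (θ₀ : EuclideanSpace ℝ (Fin p))
    {x : ℕ → Ω → EuclideanSpace ℝ (Fin p)} {ξ : ℕ → Ω → ℝ} {k : ℕ}
    (hx : ∀ j < k, Measurable (x j)) (hξ : ∀ j < k, Measurable (ξ j)) :
    Measurable fun ω => mixedWeight R θ₀ (fun j => x j ω) (fun j => ξ j ω) k := by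
  unfold mixedWeight
  refine Measurable.const_mul ?_ _
  refine Measurable.lintegral_prod_right' (f := fun z : Ω × EuclideanSpace ℝ (Fin p) =>
    ENNReal.ofReal (Real.exp (logWeight θ₀ (fun j => x j z.1) (fun j => ξ j z.1) k z.2))) ?_
  exact (measurable_logWeight θ₀ hx hξ).exp.ennreal_ofReal

lemma mixedWeight_zero_le_one (R : ℝ) (θ₀ : EuclideanSpace ℝ (Fin p))
    (x : ℕ → EuclideanSpace ℝ (Fin p)) (ξ : ℕ → ℝ) : mixedWeight R θ₀ x ξ 0 ≤ 1 := by
  simp only [mixedWeight, logWeight, Finset.range_zero, Finset.sum_empty, Real.exp_zero,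
    ENNReal.ofReal_one, lintegral_one, Measure.restrict_apply MeasurableSet.univ, Set.univ_inter]
  exact ENNReal.inv_mul_le_one _

/-- By Tonelli it suffices to fix `θ`. The new factor is then an exponential weight with tilt `⟪θ -
θ₀, x k⟫`, which is predictable because `x k`, unlike `ξ k`, is `m`-measurable. -/
lemma setLIntegral_mixedWeight_succ_le {Ω : Type*} {m m0 : MeasurableSpace Ω} (hm : m ≤ m0)
    {μ : Measure Ω} [IsProbabilityMeasure μ] (R : ℝ) (θ₀ : EuclideanSpace ℝ (Fin p))
    {x : ℕ → Ω → EuclideanSpace ℝ (Fin p)} {ξ : ℕ → Ω → ℝ} {k : ℕ}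
    (hx : ∀ j ≤ k, Measurable[m] (x j)) (hξ : ∀ j < k, Measurable[m] (ξ j))
    (hξk : Measurable (ξ k))
    (hint : ∀ l : ℝ, Integrable (fun ω => Real.exp (l * ξ k ω)) μ)
    (hle : ∀ l : ℝ, ∀ᵐ ω ∂μ, (μ[fun ω => Real.exp (l * ξ k ω) | m]) ω ≤ Real.exp (l ^ 2 / 2))
    {A : Set Ω} (hA : MeasurableSet[m] A) :
    ∫⁻ ω in A, mixedWeight R θ₀ (fun j => x j ω) (fun j => ξ j ω) (k + 1) ∂μ
      ≤ ∫⁻ ω in A, mixedWeight R θ₀ (fun j => x j ω) (fun j => ξ j ω) k ∂μ := by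
  have hx' : ∀ j ≤ k, Measurable (x j) := fun j hj => (hx j hj).mono hm le_rfl
  have hξ' : ∀ j < k, Measurable (ξ j) := fun j hj => (hξ j hj).mono hm le_rfl
  have hξ'' : ∀ j < k + 1, Measurable (ξ j) := fun j hj => by
    rcases (Nat.lt_succ_iff_lt_or_eq.1 hj) with h | rfl
    exacts [hξ' j h, hξk]
  have hsw : ∀ n, (∀ j < n, Measurable (x j)) → (∀ j < n, Measurable (ξ j)) →
      ∫⁻ ω in A, mixedWeight R θ₀ (fun j => x j ω) (fun j => ξ j ω) n ∂μ =
        (volume (Metric.closedBall (0 : EuclideanSpace ℝ (Fin p)) R))⁻¹ *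
        ∫⁻ θ in Metric.closedBall (0 : EuclideanSpace ℝ (Fin p)) R, ∫⁻ ω in A,
          ENNReal.ofReal (Real.exp
            (logWeight θ₀ (fun j => x j ω) (fun j => ξ j ω) n θ)) ∂μ := by
    intro n h1 h2
    have hmeas := (measurable_logWeight θ₀ h1 h2).exp.ennreal_ofReal
    unfold mixedWeight
    rw [lintegral_const_mul _ (Measurable.lintegral_prod_right' hmeas),
      lintegral_lintegral_swap hmeas.aemeasurable]
  rw [hsw (k + 1) (fun j hj => hx' j (Nat.lt_succ_iff.1 hj)) hξ'',
    hsw k (fun j hj => hx' j hj.le) hξ']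
  refine mul_le_mul' le_rfl (lintegral_mono fun θ => ?_)
  have hL : Measurable[m] fun ω => ⟪θ - θ₀, x k ω⟫ := @measurable_const_inner p Ω m _ _ (hx k le_rfl)
  have hZ : Measurable[m] (A.indicator fun ω => ENNReal.ofReal (Real.exp
      (logWeight θ₀ (fun j => x j ω) (fun j => ξ j ω) k θ))) := by
    exact Measurable.indicator (@measurable_logWeight_left p Ω m θ₀ θ x ξ k
      (fun j hj => hx j hj.le) hξ).exp.ennreal_ofReal hA
  have h := lintegral_mul_exp_le hm hξk hint hle hL hZ
  rw [lintegral_indicator (hm _ hA)] at h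
  refine le_trans (le_of_eq ?_) h
  rw [← lintegral_indicator (hm _ hA)]
  refine lintegral_congr fun ω => ?_
  by_cases hω : ω ∈ A
  · simp only [Set.indicator_of_mem hω, logWeight, Finset.sum_range_succ]
    rw [← ENNReal.ofReal_mul (Real.exp_pos _).le, ← Real.exp_add]
  · simp [Set.indicator_of_notMem hω]

/-- A centred exponential average over a ball is at least its volume. -/
lemma volume_closedBall_le_lintegral_exp (b : EuclideanSpace ℝ (Fin p)) (r : ℝ) :
    volume (Metric.closedBall (0 : EuclideanSpace ℝ (Fin p)) r) ≤
      ∫⁻ v in Metric.closedBall (0 : EuclideanSpace ℝ (Fin p)) r,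
        ENNReal.ofReal (Real.exp ⟪v, b⟫) := by
  have hm : Measurable fun v : EuclideanSpace ℝ (Fin p) => ENNReal.ofReal (Real.exp ⟪v, b⟫) :=
    (Measurable.inner measurable_id measurable_const).exp.ennreal_ofReal
  -- Averaging `v` with `-v` reduces the claim to `exp s + exp (-s) ≥ 2`.
  have hneg : ∫⁻ v in Metric.closedBall (0 : EuclideanSpace ℝ (Fin p)) r,
        ENNReal.ofReal (Real.exp ⟪-v, b⟫) =
      ∫⁻ v in Metric.closedBall (0 : EuclideanSpace ℝ (Fin p)) r,
        ENNReal.ofReal (Real.exp ⟪v, b⟫) := by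
    have := (Measure.measurePreserving_neg
      (volume : Measure (EuclideanSpace ℝ (Fin p)))).setLIntegral_comp_preimage
      (s := Metric.closedBall 0 r) measurableSet_closedBall hm
    rw [← this]
    congr 2
    ext v; simp
  have h2 : 2 * volume (Metric.closedBall (0 : EuclideanSpace ℝ (Fin p)) r) ≤
      2 * ∫⁻ v in Metric.closedBall (0 : EuclideanSpace ℝ (Fin p)) r,
        ENNReal.ofReal (Real.exp ⟪v, b⟫) := by
    conv_rhs => rw [two_mul]
    nth_rewrite 1 [← hneg]
    rw [← lintegral_add_right _ hm, ← setLIntegral_const]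
    refine lintegral_mono fun v => ?_
    rw [← ENNReal.ofReal_add (Real.exp_pos _).le (Real.exp_pos _).le, inner_neg_left]
    calc (2 : ℝ≥0∞) = ENNReal.ofReal 2 := by simp
      _ ≤ _ := ENNReal.ofReal_le_ofReal (by
        linarith [Real.add_one_le_exp (-⟪v, b⟫), Real.add_one_le_exp ⟪v, b⟫])
  exact (ENNReal.mul_le_mul_iff_right two_ne_zero ENNReal.ofNat_ne_top).1 h2

/-- `logWeight` is quadratic in `θ`: the displacement `v` contributes a linear term, which later
averages out by symmetry, and a quadratic loss of at most `η ^ 2 / 2` per observation. -/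
lemma logWeight_add_ge (θ₀ θ v : EuclideanSpace ℝ (Fin p)) {x : ℕ → EuclideanSpace ℝ (Fin p)}
    (ξ : ℕ → ℝ) {k : ℕ} (hx : ∀ j < k, ‖x j‖ ≤ 1) {η : ℝ} (hv : ‖v‖ ≤ η) :
    logWeight θ₀ x ξ k θ - k * η ^ 2 / 2 +
        ⟪v, ∑ j ∈ Finset.range k, (ξ j - ⟪θ - θ₀, x j⟫) • x j⟫
      ≤ logWeight θ₀ x ξ k (θ + v) := by
  have hk : (k * η ^ 2 / 2 : ℝ) = ∑ j ∈ Finset.range k, η ^ 2 / 2 := by simp; ring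
  rw [logWeight, logWeight, hk, inner_sum, ← Finset.sum_sub_distrib, ← Finset.sum_add_distrib]
  refine Finset.sum_le_sum fun j hj => ?_
  have h1 : |⟪v, x j⟫| ≤ η := by
    calc |⟪v, x j⟫| ≤ ‖v‖ * ‖x j‖ := abs_real_inner_le_norm _ _
      _ ≤ ‖v‖ * 1 := by gcongr; exact hx j (Finset.mem_range.1 hj)
      _ ≤ η := by simpa using hv
  have h2 : ⟪v, x j⟫ ^ 2 ≤ η ^ 2 := sq_le_sq' (abs_le.1 h1).1 (abs_le.1 h1).2
  have h3 : θ + v - θ₀ = (θ - θ₀) + v := by abel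
  rw [h3, inner_add_left, inner_smul_right]
  nlinarith

/-- The mixture is at least the likelihood ratio of any parameter of the smaller ball, up to the
price of the localisation at scale `η`. -/
lemma ofReal_exp_le_mixedWeight {B η : ℝ} (hB : 0 < B) (hη : 0 < η) (hη1 : η ≤ 1)
    (θ₀ : EuclideanSpace ℝ (Fin p)) {θ : EuclideanSpace ℝ (Fin p)} (hθ : ‖θ‖ ≤ B)
    {x : ℕ → EuclideanSpace ℝ (Fin p)} (ξ : ℕ → ℝ) {k : ℕ} (hx : ∀ j < k, ‖x j‖ ≤ 1) :
    ENNReal.ofReal (Real.exp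
        (logWeight θ₀ x ξ k θ - k * η ^ 2 / 2 - p * Real.log ((B + 1) / η)))
      ≤ mixedWeight (B + 1) θ₀ x ξ k := by
  set a := logWeight θ₀ x ξ k θ - k * η ^ 2 / 2 with ha
  set b := ∑ j ∈ Finset.range k, (ξ j - ⟪θ - θ₀, x j⟫) • x j with hb
  set V := volume (Metric.ball (0 : EuclideanSpace ℝ (Fin p)) 1) with hV
  have hV0 : V ≠ 0 := (Metric.measure_ball_pos _ _ one_pos).ne'
  have hVt : V ≠ ⊤ := measure_ball_lt_top.ne
  have hvol : ∀ r : ℝ, 0 ≤ r → volume (Metric.closedBall (0 : EuclideanSpace ℝ (Fin p)) r) =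
      ENNReal.ofReal (r ^ p) * V := by
    intro r hr
    rw [Measure.addHaar_closedBall _ _ hr, finrank_euclideanSpace_fin]
  have hlow : ENNReal.ofReal (Real.exp a) * (ENNReal.ofReal (η ^ p) * V) ≤
      ∫⁻ θ in Metric.closedBall (0 : EuclideanSpace ℝ (Fin p)) (B + 1),
        ENNReal.ofReal (Real.exp (logWeight θ₀ x ξ k θ)) := by
    rw [← hvol η hη.le]
    calc _ ≤ ENNReal.ofReal (Real.exp a) *
          ∫⁻ v in Metric.closedBall (0 : EuclideanSpace ℝ (Fin p)) η,
            ENNReal.ofReal (Real.exp ⟪v, b⟫) := by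
          gcongr; exact volume_closedBall_le_lintegral_exp b η
      _ ≤ ∫⁻ v in Metric.closedBall (0 : EuclideanSpace ℝ (Fin p)) η,
            ENNReal.ofReal (Real.exp a) * ENNReal.ofReal (Real.exp ⟪v, b⟫) :=
          lintegral_const_mul_le _ _
      _ ≤ ∫⁻ v in Metric.closedBall (0 : EuclideanSpace ℝ (Fin p)) η,
            ENNReal.ofReal (Real.exp (logWeight θ₀ x ξ k (θ + v))) := by
          refine setLIntegral_mono' measurableSet_closedBall fun v hv => ?_
          rw [← ENNReal.ofReal_mul (Real.exp_pos _).le, ← Real.exp_add]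
          exact ENNReal.ofReal_le_ofReal (Real.exp_le_exp.2
            (logWeight_add_ge θ₀ θ v ξ hx (mem_closedBall_zero_iff.1 hv)))
      -- As `η ≤ 1`, the ball of radius `η` around `θ` stays inside the ball of radius `B + 1`.
      _ ≤ ∫⁻ v in (fun v => θ + v) ⁻¹' Metric.closedBall 0 (B + 1),
            ENNReal.ofReal (Real.exp (logWeight θ₀ x ξ k (θ + v))) := by
          refine lintegral_mono_set fun v hv => ?_
          have := mem_closedBall_zero_iff.1 hv
          simp only [Set.mem_preimage, mem_closedBall_zero_iff]
          linarith [norm_add_le θ v]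
      _ = _ := by
          refine (measurePreserving_add_left volume θ).setLIntegral_comp_preimage
            (f := fun θ => ENNReal.ofReal (Real.exp (logWeight θ₀ x ξ k θ)))
            measurableSet_closedBall ?_
          refine Measurable.ennreal_ofReal (Measurable.exp ?_)
          have : Continuous (logWeight θ₀ x ξ k) := by unfold logWeight; fun_prop
          exact this.measurable
  have hexp : Real.exp (a - p * Real.log ((B + 1) / η)) =
      Real.exp a * (η ^ p / (B + 1) ^ p) := by
    rw [sub_eq_add_neg, Real.exp_add, ← mul_neg, ← Real.log_inv, Real.exp_nat_mul,
      Real.exp_log (by positivity), inv_div, div_pow]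
  unfold mixedWeight
  have hR : 0 < (B + 1) ^ p := by positivity
  rw [hexp, hvol (B + 1) (by linarith), ← ENNReal.div_eq_inv_mul, ENNReal.le_div_iff_mul_le
    (Or.inl (mul_ne_zero (ENNReal.ofReal_pos.2 hR).ne' hV0))
    (Or.inl (ENNReal.mul_ne_top ENNReal.ofReal_ne_top hVt))]
  refine le_trans (le_of_eq ?_) hlow
  rw [← mul_assoc, ← mul_assoc, ← ENNReal.ofReal_mul (by positivity),
    ← ENNReal.ofReal_mul (by positivity)]
  congr 2
  field_simp

end Mixture

end MixingBandit
end

noncomputable section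

namespace MixingBandit

/-! ### Innovations at delay `d` and residue classes. -/

section Noise

variable {Ω : Type*} {ε : ℕ → Ω → ℝ}

lemma noiseSigma_mono : Monotone (noiseSigma ε) := fun _ _ hst =>
  biSup_mono fun _ hi => Finset.Icc_subset_Icc_right hst hi

lemma noiseSigma_zero : noiseSigma ε 0 = ⊥ := by simp [noiseSigma]

lemma measurable_noise {s : ℕ} (hs : 1 ≤ s) : Measurable[noiseSigma ε s] (ε s) :=
  Measurable.mono (comap_measurable (ε s))
    (le_biSup (fun s => MeasurableSpace.comap (ε s) inferInstance)
      (Finset.mem_Icc.2 ⟨hs, le_rfl⟩)) le_rfl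

variable [MeasurableSpace Ω] {μ : Measure Ω} {φ : ℕ → ℝ≥0∞}

/-- The innovation of the noise relative to the information available `d` rounds earlier. -/
def innovation (μ : Measure Ω) (ε : ℕ → Ω → ℝ) (d s : ℕ) (ω : Ω) : ℝ :=
  ε s ω - (μ[ε s | noiseSigma ε (s - d)]) ω

lemma IsMixingSubgaussian.noiseSigma_le (h : IsMixingSubgaussian μ 1 φ ε) (t : ℕ) :
    noiseSigma ε t ≤ ‹MeasurableSpace Ω› :=
  iSup₂_le fun s hs => (h.measurable s (Finset.mem_Icc.1 hs).1).comap_le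

lemma measurable_innovation {d s : ℕ} (hs : 1 ≤ s) :
    Measurable[noiseSigma ε s] (innovation μ ε d s) :=
  Measurable.sub (measurable_noise hs)
    (stronglyMeasurable_condExp.measurable.mono (noiseSigma_mono (Nat.sub_le s d)) le_rfl)

variable [IsProbabilityMeasure μ]

/-- For `s ≤ d` the truncated difference `s - d` is `0` and `F 0` is trivial. The innovation is then
the noise itself, and the unconditional sub-Gaussian hypothesis takes over in rounds where the
mixing hypotheses say nothing. -/
lemma IsMixingSubgaussian.condExp_eq_zero (h : IsMixingSubgaussian μ 1 φ ε) {d s : ℕ} (hs : 1 ≤ s)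
    (hsd : s ≤ d) (ω : Ω) : (μ[ε s | noiseSigma ε (s - d)]) ω = 0 := by
  rw [Nat.sub_eq_zero_of_le hsd, noiseSigma_zero, condExp_bot, h.centred s hs]

lemma IsMixingSubgaussian.abs_condExp_le (h : IsMixingSubgaussian μ 1 φ ε) {d s : ℕ} (hs : 1 ≤ s)
    (hφ : φ d ≠ ⊤) : ∀ᵐ ω ∂μ, |(μ[ε s | noiseSigma ε (s - d)]) ω| ≤ (φ d).toReal := by
  rcases le_or_gt s d with hsd | hsd
  · filter_upwards with ω
    rw [h.condExp_eq_zero hs hsd, abs_zero]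
    exact ENNReal.toReal_nonneg
  · filter_upwards [h.mixing d s hsd] with ω hω
    rw [← Real.norm_eq_abs, ← toReal_enorm]
    exact ENNReal.toReal_mono hφ hω

lemma IsMixingSubgaussian.integrable_exp_innovation (h : IsMixingSubgaussian μ 1 φ ε) {d s : ℕ}
    (hs : 1 ≤ s) (hφ : φ d ≠ ⊤) (l : ℝ) :
    Integrable (fun ω => Real.exp (l * innovation μ ε d s ω)) μ := by
  have hmeas : Measurable (innovation μ ε d s) :=
    (measurable_innovation hs).mono (h.noiseSigma_le s) le_rfl
  refine Integrable.mono' (((h.subgaussian s hs).integrable_exp_mul l).const_mul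
    (Real.exp (|l| * (φ d).toReal))) (by fun_prop) ?_
  filter_upwards [h.abs_condExp_le hs hφ] with ω hω
  rw [Real.norm_eq_abs, Real.abs_exp, ← Real.exp_add, Real.exp_le_exp, innovation]
  have : -(l * (μ[ε s | noiseSigma ε (s - d)]) ω) ≤ |l| * (φ d).toReal :=
    (neg_le_abs _).trans (by rw [abs_mul]; gcongr)
  linarith

lemma IsMixingSubgaussian.condExp_exp_innovation_le (h : IsMixingSubgaussian μ 1 φ ε) {d s : ℕ}
    (hs : 1 ≤ s) (l : ℝ) :
    ∀ᵐ ω ∂μ, (μ[fun ω => Real.exp (l * innovation μ ε d s ω) | noiseSigma ε (s - d)]) ω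
      ≤ Real.exp (l ^ 2 / 2) := by
  rcases le_or_gt s d with hsd | hsd
  · filter_upwards with ω
    simp only [innovation, h.condExp_eq_zero hs hsd, sub_zero]
    rw [Nat.sub_eq_zero_of_le hsd, noiseSigma_zero, condExp_bot]
    have := (h.subgaussian s hs).mgf_le l
    simpa [mgf] using this
  · filter_upwards [h.cond_subgaussian d s hsd l] with ω hω
    simpa [innovation] using hω

end Noise

/-- Each round is uniquely `i + 1 + j * d` with `i < d`; the number of admissible `j` is `(t - i) /
d` rounded up, and `0` if `i ≥ t`. -/
lemma sum_Icc_eq_sum_residue (f : ℕ → ℝ) {d : ℕ} (hd : 0 < d) (t : ℕ) :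
    ∑ s ∈ Finset.Icc 1 t, f s =
      ∑ i ∈ Finset.range d, ∑ j ∈ Finset.range ((t + d - 1 - i) / d), f (i + 1 + j * d) := by
  rw [Finset.sum_sigma']
  refine Finset.sum_nbij' (fun s => ⟨(s - 1) % d, (s - 1) / d⟩) (fun z => z.1 + 1 + z.2 * d)
    ?_ ?_ ?_ ?_ ?_
  · intro s hs
    obtain ⟨h1, h2⟩ := Finset.mem_Icc.1 hs
    have h3 := Nat.mod_lt (s - 1) hd
    have h4 := Nat.mod_add_div (s - 1) d
    simp only [Finset.mem_sigma, Finset.mem_range]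
    refine ⟨h3, ?_⟩
    rw [Nat.lt_iff_add_one_le, Nat.le_div_iff_mul_le hd, add_mul, one_mul, mul_comm]
    omega
  · rintro ⟨i, j⟩ hz
    simp only [Finset.mem_sigma, Finset.mem_range] at hz
    obtain ⟨h1, h2⟩ := hz
    rw [Nat.lt_iff_add_one_le, Nat.le_div_iff_mul_le hd, add_mul, one_mul] at h2
    simp only [Finset.mem_Icc]
    omega
  · intro s hs
    obtain ⟨h1, h2⟩ := Finset.mem_Icc.1 hs
    have h4 := Nat.mod_add_div (s - 1) d
    simp only
    rw [mul_comm] at h4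
    omega
  · rintro ⟨i, j⟩ hz
    simp only [Finset.mem_sigma, Finset.mem_range] at hz
    have h1 : i + 1 + j * d - 1 = i + d * j := by rw [mul_comm]; omega
    simp only [h1, Nat.add_mul_mod_self_left, Nat.mod_eq_of_lt hz.1, Nat.add_mul_div_left _ _ hd,
      Nat.div_eq_of_lt hz.1, zero_add]
  · intro s hs
    obtain ⟨h1, h2⟩ := Finset.mem_Icc.1 hs
    have h4 := Nat.mod_add_div (s - 1) d
    simp only
    rw [mul_comm] at h4
    congr 1
    omega

/-! ### Concentration uniform in parameters and rounds. -/

section Concentration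

variable {p : ℕ} {Ω : Type*} [MeasurableSpace Ω] {μ : Measure Ω} [IsProbabilityMeasure μ]
  {φ : ℕ → ℝ≥0∞} {ε : ℕ → Ω → ℝ}

/-- The filtration is `F (i + 1 + k * d - d)`: it already contains the innovations with index `j <
k`, which are at least `d` rounds old, and makes the `k`-th arm of the class predictable. -/
lemma exists_lintegral_le_two_of_residue (h : IsMixingSubgaussian μ 1 φ ε) {d : ℕ}
    (hφ : φ d ≠ ⊤) {X : ℕ → Ω → EuclideanSpace ℝ (Fin p)}
    (hX : ∀ t, 1 ≤ t → Measurable[noiseSigma ε (t - d)] (X t)) (R : ℝ)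
    (θ₀ : EuclideanSpace ℝ (Fin p)) (i n : ℕ) :
    ∃ N : Ω → ℝ≥0∞, Measurable N ∧ ∫⁻ ω, N ω ∂μ ≤ 2 ∧
      ∀ ω, ∀ k ≤ n, ∀ a : ℝ, ENNReal.ofReal (Real.exp a) ≤
        mixedWeight R θ₀ (fun j => X (i + 1 + j * d) ω)
          (fun j => innovation μ ε d (i + 1 + j * d) ω) k → ENNReal.ofReal a ≤ N ω := by
  have hpos : ∀ j, 1 ≤ i + 1 + j * d := fun j => by omega
  have hmono : Monotone fun k => noiseSigma ε (i + 1 + k * d - d) := fun k l hkl =>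
    noiseSigma_mono (Nat.sub_le_sub_right (Nat.add_le_add_left (Nat.mul_le_mul_right d hkl) _) d)
  have hξ : ∀ j k, j < k →
      Measurable[noiseSigma ε (i + 1 + k * d - d)] (innovation μ ε d (i + 1 + j * d)) := by
    intro j k hjk
    refine (measurable_innovation (hpos j)).mono (noiseSigma_mono ?_) le_rfl
    have : (j + 1) * d ≤ k * d := Nat.mul_le_mul_right d hjk
    rw [add_mul, one_mul] at this
    omega
  have hx : ∀ j k, j ≤ k →
      Measurable[noiseSigma ε (i + 1 + k * d - d)] (X (i + 1 + j * d)) := fun j k hjk =>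
    (hX _ (hpos j)).mono (hmono hjk) le_rfl
  refine exists_lintegral_le_two_of_supermartingale (M := fun k ω =>
    mixedWeight R θ₀ (fun j => X (i + 1 + j * d) ω)
      (fun j => innovation μ ε d (i + 1 + j * d) ω) k)
    (G := fun k => noiseSigma ε (i + 1 + k * d - d)) (fun k => h.noiseSigma_le _) hmono ?_ ?_ ?_ n
  · intro k
    exact @measurable_mixedWeight p Ω (noiseSigma ε (i + 1 + k * d - d)) R θ₀
      (fun j => X (i + 1 + j * d)) (fun j => innovation μ ε d (i + 1 + j * d)) k
      (fun j hj => hx j k hj.le) (fun j hj => hξ j k hj)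
  · intro k A hA
    exact setLIntegral_mixedWeight_succ_le (h.noiseSigma_le _) R θ₀
      (x := fun j => X (i + 1 + j * d)) (ξ := fun j => innovation μ ε d (i + 1 + j * d))
      (fun j hj => hx j k hj) (fun j hj => hξ j k hj)
      ((measurable_innovation (hpos k)).mono (h.noiseSigma_le _) le_rfl)
      (h.integrable_exp_innovation (hpos k) hφ) (h.condExp_exp_innovation_le (hpos k)) hA
  · calc _ ≤ ∫⁻ _, 1 ∂μ := lintegral_mono fun ω => mixedWeight_zero_le_one _ _ _ _
      _ = 1 := by simp

/-- With high probability, the log-likelihood ratios of all parameters are controlled in all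
rounds. -/
lemma exists_event_sum_le (h : IsMixingSubgaussian μ 1 φ ε) {d : ℕ} (hd : 0 < d) (hp : 1 ≤ p)
    (hφ : φ d ≠ ⊤) {X : ℕ → Ω → EuclideanSpace ℝ (Fin p)}
    (hX : ∀ t, 1 ≤ t → Measurable[noiseSigma ε (t - d)] (X t)) (hX1 : ∀ t, 1 ≤ t → ∀ ω, ‖X t ω‖ ≤ 1)
    {B δ : ℝ} (hB : 0 < B) (hδ : 0 < δ) (θ₀ : EuclideanSpace ℝ (Fin p)) (T : ℕ) :
    ∃ S : Set Ω, ENNReal.ofReal (1 - δ) ≤ μ S ∧ ∀ ω ∈ S, ∀ t ≤ T, ∀ θ, ‖θ‖ ≤ B →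
      ∑ s ∈ Finset.Icc 1 t, (⟪θ - θ₀, X s ω⟫ * innovation μ ε d s ω - ⟪θ - θ₀, X s ω⟫ ^ 2 / 2) ≤
        ((d : ℝ) * p / 2) *
          Real.log ((B + 1) ^ 2 * Real.exp 1 * max ((d : ℝ) * p) ((t : ℝ) + d) / ((d : ℝ) * p))
        + 2 * d / δ := by
  choose N hNm hN2 hN using fun i =>
    exists_lintegral_le_two_of_residue h hφ hX (B + 1) θ₀ i (T + d)
  set F : Ω → ℝ≥0∞ := fun ω => ∑ i ∈ Finset.range d, N i ω with hF
  have hFm : Measurable F := Finset.measurable_sum _ fun i _ => hNm i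
  have hFint : ∫⁻ ω, F ω ∂μ ≤ ENNReal.ofReal (2 * d) := by
    rw [lintegral_finsetSum _ fun i _ => hNm i]
    calc _ ≤ ∑ i ∈ Finset.range d, (2 : ℝ≥0∞) := Finset.sum_le_sum fun i _ => hN2 i
      _ = _ := by
        rw [Finset.sum_const, Finset.card_range, nsmul_eq_mul, ENNReal.ofReal_mul (by norm_num)]
        simp [mul_comm]
  have hd' : (0 : ℝ) < d := Nat.cast_pos.2 hd
  have hp' : (0 : ℝ) < p := Nat.cast_pos.2 hp
  have hc : 0 < 2 * d / δ := by positivity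
  have hbad : μ {ω | ENNReal.ofReal (2 * d / δ) ≤ F ω} ≤ ENNReal.ofReal δ := by
    have h1 := (mul_meas_ge_le_lintegral hFm (ENNReal.ofReal (2 * d / δ))).trans hFint
    rw [mul_comm, ← ENNReal.le_div_iff_mul_le (Or.inl (ENNReal.ofReal_pos.2 hc).ne')
      (Or.inl ENNReal.ofReal_ne_top), ← ENNReal.ofReal_div_of_pos hc] at h1
    refine h1.trans (le_of_eq ?_)
    congr 1; field_simp
  refine ⟨{ω | ENNReal.ofReal (2 * d / δ) ≤ F ω}ᶜ, ?_, ?_⟩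
  · rw [prob_compl_eq_one_sub (measurableSet_le measurable_const hFm),
      ENNReal.ofReal_sub _ hδ.le, ENNReal.ofReal_one]
    exact tsub_le_tsub_left hbad _
  intro ω hω t ht θ hθ
  set m : ℝ := max ((d : ℝ) * p) ((t : ℝ) + d) with hm
  have hmpos : 0 < m := lt_max_of_lt_left (by positivity)
  -- A class has at most `(t + d) / d ≤ m / d` rounds, so this scale makes the quadratic loss at
  -- most `p / 2`. The scale may depend on `t` because the variables `N i` do not involve it.
  set η : ℝ := √(d * p / m) with hη
  have hη2 : η ^ 2 = d * p / m := Real.sq_sqrt (by positivity)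
  have hηpos : 0 < η := Real.sqrt_pos.2 (by positivity)
  have hη1 : η ≤ 1 := Real.sqrt_le_one.2 ((div_le_one hmpos).2 (le_max_left _ _))
  set κ : ℕ → ℕ := fun i => (t + d - 1 - i) / d with hκ
  have hκd : ∀ i, (κ i : ℝ) * d ≤ t + d := fun i => by
    have : κ i * d ≤ t + d := (Nat.div_mul_le_self _ _).trans (by omega)
    exact_mod_cast this
  have hκT : ∀ i, κ i ≤ T + d := fun i => (Nat.div_le_self _ _).trans (by omega)
  set ℓ : ℕ → ℝ := fun i => logWeight θ₀ (fun j => X (i + 1 + j * d) ω)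
    (fun j => innovation μ ε d (i + 1 + j * d) ω) (κ i) θ with hℓ
  set c : ℝ := p / 2 * Real.log ((B + 1) ^ 2 * Real.exp 1 * m / ((d : ℝ) * p)) with hcdef
  -- The total price in one class is exactly `1 / d` times the logarithmic term of the radius.
  have hlog : p / 2 + p * Real.log ((B + 1) / η) = c := by
    have e1 : (B + 1) ^ 2 * Real.exp 1 * m / ((d : ℝ) * p) = Real.exp 1 * ((B + 1) / η) ^ 2 := by
      rw [div_pow, hη2]; field_simp
    rw [hcdef, e1, Real.log_mul (Real.exp_pos _).ne' (by positivity), Real.log_exp, Real.log_pow]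
    push_cast; ring
  have hblock : ∀ i, ENNReal.ofReal (ℓ i - c) ≤ N i ω := by
    intro i
    refine hN i ω (κ i) (hκT i) _ (le_trans (ENNReal.ofReal_le_ofReal (Real.exp_le_exp.2 ?_))
      (ofReal_exp_le_mixedWeight hB hηpos hη1 θ₀ hθ _ (fun j _ => hX1 _ (by omega) ω)))
    rw [← hlog]
    have : (κ i : ℝ) * η ^ 2 / 2 ≤ p / 2 := by
      rw [hη2]
      have h1 : (κ i : ℝ) * d ≤ m := (hκd i).trans (le_max_right _ _)
      have h2 : (κ i : ℝ) * (d * p / m) = (κ i * d / m) * p := by ring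
      have h3 : (κ i : ℝ) * d / m ≤ 1 := (div_le_one hmpos).2 h1
      rw [h2]
      nlinarith
    linarith
  have hsum : ENNReal.ofReal (∑ i ∈ Finset.range d, (ℓ i - c)) ≤ F ω :=
    calc _ ≤ ENNReal.ofReal (∑ i ∈ Finset.range d, max (ℓ i - c) 0) :=
          ENNReal.ofReal_le_ofReal (Finset.sum_le_sum fun i _ => le_max_left _ _)
      _ = ∑ i ∈ Finset.range d, ENNReal.ofReal (max (ℓ i - c) 0) :=
          ENNReal.ofReal_sum_of_nonneg fun i _ => le_max_right _ _
      _ ≤ F ω := Finset.sum_le_sum fun i _ => by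
          rw [ENNReal.ofReal_max]; simpa using hblock i
  have hlt : ∑ i ∈ Finset.range d, (ℓ i - c) < 2 * d / δ :=
    (ENNReal.ofReal_lt_ofReal_iff hc).1 (hsum.trans_lt (not_le.1 hω))
  rw [Finset.sum_sub_distrib, Finset.sum_const, Finset.card_range, nsmul_eq_mul] at hlt
  rw [sum_Icc_eq_sum_residue _ hd]
  have hdc : (d : ℝ) * c = ((d : ℝ) * p / 2) *
      Real.log ((B + 1) ^ 2 * Real.exp 1 * m / ((d : ℝ) * p)) := by rw [hcdef]; ring
  rw [← hdc]
  have : ∑ i ∈ Finset.range d, ℓ i < d * c + 2 * d / δ := by linarith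
  exact this.le

end Concentration

end MixingBandit
end

noncomputable section

namespace MixingBandit

/-! ### Validity of the confidence sets. -/

section LeastSquares

variable {p : ℕ}

lemma dotProduct_featureCov_mulVec (lam : ℝ) (X : ℕ → EuclideanSpace ℝ (Fin p)) (t : ℕ)
    (u : EuclideanSpace ℝ (Fin p)) :
    u.ofLp ⬝ᵥ ((featureCov lam X t).mulVec u.ofLp) =
      ∑ s ∈ Finset.Icc 1 t, ⟪u, X s⟫ ^ 2 + lam * ‖u‖ ^ 2 := by
  have h1 : ∀ x : EuclideanSpace ℝ (Fin p), u.ofLp ⬝ᵥ x.ofLp = ⟪u, x⟫ := fun x => by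
    rw [EuclideanSpace.inner_eq_star_dotProduct, star_trivial, dotProduct_comm]
  simp only [featureCov, Matrix.add_mulVec, Matrix.sum_mulVec, Matrix.smul_mulVec,
    Matrix.one_mulVec, dotProduct_add, dotProduct_sum, dotProduct_smul, smul_eq_mul]
  congr 1
  · refine Finset.sum_congr rfl fun s _ => ?_
    rw [Matrix.vecMulVec_mulVec, dotProduct_smul, h1, dotProduct_comm (X s).ofLp, h1]
    simp [sq]
  · rw [h1, real_inner_self_eq_norm_sq]

lemma weightedNorm_featureCov_sq {lam : ℝ} (hlam : 0 ≤ lam) (X : ℕ → EuclideanSpace ℝ (Fin p))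
    (t : ℕ) (u : EuclideanSpace ℝ (Fin p)) :
    weightedNorm (featureCov lam X t) u ^ 2 =
      ∑ s ∈ Finset.Icc 1 t, ⟪u, X s⟫ ^ 2 + lam * ‖u‖ ^ 2 := by
  rw [weightedNorm, dotProduct_featureCov_mulVec, Real.sq_sqrt]
  have := Finset.sum_nonneg fun s (_ : s ∈ Finset.Icc 1 t) => sq_nonneg ⟪u, X s⟫
  positivity

/-- First-order optimality of the constrained least-squares estimator. -/
lemma IsLeastSquares.sum_sq_le {B : ℝ} {X : ℕ → EuclideanSpace ℝ (Fin p)} {Y : ℕ → ℝ} {t : ℕ}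
    {θhat : EuclideanSpace ℝ (Fin p)} (h : IsLeastSquares B X Y t θhat)
    {θ : EuclideanSpace ℝ (Fin p)} (hθ : θ ∈ Metric.closedBall 0 B) :
    ∑ s ∈ Finset.Icc 1 t, ⟪θhat - θ, X s⟫ ^ 2 ≤
      ∑ s ∈ Finset.Icc 1 t, (⟪θ, X s⟫ - Y s) ^ 2 -
        ∑ s ∈ Finset.Icc 1 t, (⟪θhat, X s⟫ - Y s) ^ 2 := by
  set q := ∑ s ∈ Finset.Icc 1 t, ⟪θhat - θ, X s⟫ ^ 2 with hq
  set c := ∑ s ∈ Finset.Icc 1 t, ⟪θ - θhat, X s⟫ * (⟪θhat, X s⟫ - Y s) with hc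
  have hexp : ∀ τ : ℝ, ∑ s ∈ Finset.Icc 1 t, (⟪θhat + τ • (θ - θhat), X s⟫ - Y s) ^ 2 =
      ∑ s ∈ Finset.Icc 1 t, (⟪θhat, X s⟫ - Y s) ^ 2 + 2 * τ * c + τ ^ 2 * q := by
    intro τ
    rw [hq, hc, Finset.mul_sum, Finset.mul_sum, ← Finset.sum_add_distrib,
      ← Finset.sum_add_distrib]
    refine Finset.sum_congr rfl fun s _ => ?_
    rw [inner_add_left, real_inner_smul_left, inner_sub_left, inner_sub_left]
    ring
  -- Convexity keeps the segment from `θhat` to `θ` in the ball; dividing the increase of the loss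
  -- by `τ` and letting `τ` tend to `0` gives `c ≥ 0`.
  have hmin : ∀ τ ∈ Set.Ioc (0 : ℝ) 1, 0 ≤ 2 * c + τ * q := by
    intro τ hτ
    have hmem : θhat + τ • (θ - θhat) ∈ Metric.closedBall (0 : EuclideanSpace ℝ (Fin p)) B :=
      (convex_closedBall _ _).add_smul_sub_mem h.1 hθ ⟨hτ.1.le, hτ.2⟩
    have := h.2 hmem
    simp only [Set.mem_ofPred_eq, hexp τ] at this
    by_contra! hneg
    nlinarith [hτ.1]
  have hc0 : 0 ≤ c := by
    have hlim : Filter.Tendsto (fun τ : ℝ => 2 * c + τ * q) (nhdsWithin 0 (Set.Ioi 0))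
        (nhds (2 * c + 0 * q)) := by
      refine Filter.Tendsto.mono_left (Continuous.tendsto ?_ 0) nhdsWithin_le_nhds
      fun_prop
    have := ge_of_tendsto hlim
      (Filter.mem_of_superset (Ioc_mem_nhdsGT zero_lt_one) hmin)
    linarith
  have h1 := hexp 1
  simp only [one_smul, add_sub_cancel] at h1
  rw [h1]
  linarith

/-- The radius of the confidence set. -/
def radius (p : ℕ) (B lam δ φd : ℝ) (d t : ℕ) : ℝ :=
  ((d : ℝ) * p / 2) *
      Real.log ((B + 1) ^ 2 * Real.exp 1 * max ((d : ℝ) * p) ((t : ℝ) + d) / ((d : ℝ) * p))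
    + 2 * lam * B ^ 2 + (t : ℝ) * φd * (B + 1) + (d : ℝ) * Real.log ((d : ℝ) / δ)

/-- The least-squares inequality is the log-likelihood bound at `θhat` plus the bias, which can
reach `2 B t φd`. For `B > 1` this exceeds the term `t φd (B + 1)` of the radius, so the bias and `2
d / δ` are charged to `d log (d / δ)`; this is `hslack`. -/
lemma mem_confidenceSet_of_sum_le {B lam δ φd : ℝ} (hB : 0 < B) (hlam : 0 ≤ lam) (hφ : 0 ≤ φd)
    {d t T : ℕ} (htT : t ≤ T)
    (hslack : 2 * B * T * φd + 2 * d / δ ≤ d * Real.log ((d : ℝ) / δ))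
    {X : ℕ → EuclideanSpace ℝ (Fin p)} (hX : ∀ s, 1 ≤ s → ‖X s‖ ≤ 1) {ε b : ℕ → ℝ}
    (hb : ∀ s, 1 ≤ s → |b s| ≤ φd) {θstar θhat : EuclideanSpace ℝ (Fin p)}
    (hθ : θstar ∈ Metric.closedBall 0 B)
    (hls : IsLeastSquares B X (fun s => ⟪θstar, X s⟫ + ε s) t θhat)
    (hsum : ∀ θ : EuclideanSpace ℝ (Fin p), ‖θ‖ ≤ B →
      ∑ s ∈ Finset.Icc 1 t, (⟪θ - θstar, X s⟫ * (ε s - b s) - ⟪θ - θstar, X s⟫ ^ 2 / 2) ≤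
        ((d : ℝ) * p / 2) *
          Real.log ((B + 1) ^ 2 * Real.exp 1 * max ((d : ℝ) * p) ((t : ℝ) + d) / ((d : ℝ) * p))
        + 2 * d / δ) :
    θstar ∈ confidenceSet B lam δ φd d X θhat t := by
  refine ⟨hθ, ?_⟩
  rw [weightedNorm_featureCov_sq hlam]
  have hB1 : ‖θhat‖ ≤ B := mem_closedBall_zero_iff.1 hls.1
  have hB2 : ‖θstar‖ ≤ B := mem_closedBall_zero_iff.1 hθ
  have hu : ‖θhat - θstar‖ ≤ 2 * B := (norm_sub_le _ _).trans (by linarith)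
  have h1 := hls.sum_sq_le hθ
  have h2 := hsum θhat hB1
  have h3 : ∑ s ∈ Finset.Icc 1 t, (⟪θstar, X s⟫ - (⟪θstar, X s⟫ + ε s)) ^ 2 -
        ∑ s ∈ Finset.Icc 1 t, (⟪θhat, X s⟫ - (⟪θstar, X s⟫ + ε s)) ^ 2 =
      2 * ∑ s ∈ Finset.Icc 1 t,
          (⟪θhat - θstar, X s⟫ * (ε s - b s) - ⟪θhat - θstar, X s⟫ ^ 2 / 2) +
        2 * ∑ s ∈ Finset.Icc 1 t, ⟪θhat - θstar, X s⟫ * b s := by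
    rw [← Finset.sum_sub_distrib, Finset.mul_sum, Finset.mul_sum, ← Finset.sum_add_distrib]
    refine Finset.sum_congr rfl fun s _ => ?_
    rw [inner_sub_left]; ring
  have h4 : ∑ s ∈ Finset.Icc 1 t, ⟪θhat - θstar, X s⟫ * b s ≤ t * (2 * B * φd) := by
    calc _ ≤ ∑ s ∈ Finset.Icc 1 t, 2 * B * φd := by
          refine Finset.sum_le_sum fun s hs => ?_
          have hs1 := (Finset.mem_Icc.1 hs).1
          refine (le_abs_self _).trans ?_
          rw [abs_mul]
          refine mul_le_mul ?_ (hb s hs1) (abs_nonneg _) (by linarith)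
          calc _ ≤ ‖θhat - θstar‖ * ‖X s‖ := abs_real_inner_le_norm _ _
            _ ≤ 2 * B * 1 := mul_le_mul hu (hX s hs1) (norm_nonneg _) (by linarith)
            _ = 2 * B := mul_one _
      _ = _ := by simp
  have h5 : ∑ s ∈ Finset.Icc 1 t, ⟪θstar - θhat, X s⟫ ^ 2 =
      ∑ s ∈ Finset.Icc 1 t, ⟪θhat - θstar, X s⟫ ^ 2 :=
    Finset.sum_congr rfl fun s _ => by rw [← neg_sub, inner_neg_left, neg_sq]
  have h6 : lam * ‖θstar - θhat‖ ^ 2 ≤ lam * (2 * B) ^ 2 := by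
    rw [norm_sub_rev]; gcongr
  have h7 : (t : ℝ) * (2 * B * φd) ≤ 2 * B * T * φd := by
    have : (t : ℝ) ≤ T := Nat.cast_le.2 htT
    calc (t : ℝ) * (2 * B * φd) ≤ T * (2 * B * φd) := by gcongr
      _ = _ := by ring
  have h8 : 0 ≤ (t : ℝ) * φd * (B + 1) := by positivity
  rw [h5]
  linarith

end LeastSquares

end MixingBandit
end

noncomputable section

namespace MixingBandit

/-! ### The elliptical potential. -/

section EllipticalPotential

variable {p : ℕ}

lemma featureCov_succ (lam : ℝ) (X : ℕ → EuclideanSpace ℝ (Fin p)) (t : ℕ) :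
    featureCov lam X (t + 1) =
      featureCov lam X t + Matrix.vecMulVec (X (t + 1)).ofLp (X (t + 1)).ofLp := by
  simp only [featureCov, Finset.sum_Icc_succ_top (Nat.le_add_left 1 t)]
  abel

lemma isHermitian_featureCov (lam : ℝ) (X : ℕ → EuclideanSpace ℝ (Fin p)) (t : ℕ) :
    (featureCov lam X t).IsHermitian := by
  rw [Matrix.IsHermitian, Matrix.conjTranspose_eq_transpose_of_trivial, featureCov,
    Matrix.transpose_add, Matrix.transpose_sum, Matrix.transpose_smul, Matrix.transpose_one]
  simp [Matrix.transpose_vecMulVec]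

lemma posDef_featureCov {lam : ℝ} (hlam : 0 < lam) (X : ℕ → EuclideanSpace ℝ (Fin p)) (t : ℕ) :
    (featureCov lam X t).PosDef := by
  refine Matrix.PosDef.of_dotProduct_mulVec_pos (isHermitian_featureCov lam X t) fun u hu => ?_
  have h := dotProduct_featureCov_mulVec lam X t (WithLp.toLp 2 u)
  rw [star_trivial]
  have hu' : 0 < ‖(WithLp.toLp 2 u : EuclideanSpace ℝ (Fin p))‖ := by
    rw [norm_pos_iff]
    simpa using hu
  have hs := Finset.sum_nonneg fun s (_ : s ∈ Finset.Icc 1 t) =>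
    sq_nonneg ⟪(WithLp.toLp 2 u : EuclideanSpace ℝ (Fin p)), X s⟫
  have h2 : 0 < lam * ‖(WithLp.toLp 2 u : EuclideanSpace ℝ (Fin p))‖ ^ 2 := by positivity
  calc 0 < _ := add_pos_of_nonneg_of_pos hs h2
    _ = _ := h.symm

/-- The squared norm of `x` in the metric of the inverse of the positive definite matrix `A`
controls inner products with `x`. -/
lemma sq_dotProduct_le_of_posDef {n : Type*} [Fintype n] [DecidableEq n] {A : Matrix n n ℝ}
    (hA : A.PosDef) (x u : n → ℝ) :
    (u ⬝ᵥ x) ^ 2 ≤ (x ⬝ᵥ (A⁻¹.mulVec x)) * (u ⬝ᵥ (A.mulVec u)) := by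
  set w := A⁻¹.mulVec x with hw
  have hAw : A.mulVec w = x := by
    rw [hw, Matrix.mulVec_mulVec, Matrix.mul_nonsing_inv _ hA.det_pos.ne'.isUnit, Matrix.one_mulVec]
  have hsymm : w ⬝ᵥ (A.mulVec u) = u ⬝ᵥ x := by
    have hT : A.transpose = A := by
      simpa [Matrix.IsHermitian, Matrix.conjTranspose_eq_transpose_of_trivial] using hA.isHermitian
    rw [Matrix.dotProduct_mulVec, ← Matrix.mulVec_transpose, hT, hAw, dotProduct_comm]
  -- The quadratic form of `A` at `u - c • w` is nonnegative for all `c`; its discriminant gives the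
  -- Cauchy-Schwarz inequality.
  have hquad : ∀ c : ℝ, 0 ≤ (x ⬝ᵥ w) * (c * c) + (-2 * (u ⬝ᵥ x)) * c + u ⬝ᵥ (A.mulVec u) := by
    intro c
    have h := hA.posSemidef.dotProduct_mulVec_nonneg (u - c • w)
    rw [star_trivial, Matrix.mulVec_sub, Matrix.mulVec_smul, hAw, dotProduct_sub, sub_dotProduct,
      sub_dotProduct, smul_dotProduct, smul_dotProduct, dotProduct_smul, dotProduct_smul, hsymm,
      dotProduct_comm w x] at h
    simp only [smul_eq_mul] at h
    linarith
  have := discrim_le_zero hquad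
  rw [discrim] at this
  nlinarith

lemma det_featureCov_succ {lam : ℝ} (hlam : 0 < lam) (X : ℕ → EuclideanSpace ℝ (Fin p)) (t : ℕ) :
    (featureCov lam X (t + 1)).det = (featureCov lam X t).det *
      (1 + (X (t + 1)).ofLp ⬝ᵥ ((featureCov lam X t)⁻¹.mulVec (X (t + 1)).ofLp)) := by
  rw [featureCov_succ, Matrix.vecMulVec_eq Unit, Matrix.det_add_replicateCol_mul_replicateRow
    (posDef_featureCov hlam X t).det_pos.ne'.isUnit]
  congr 1
  rw [Matrix.det_unique, Matrix.add_apply, Matrix.one_apply_eq, Matrix.dotProduct_mulVec]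
  rfl

/-- Each eigenvalue is bounded by the trace. This is cruder than the arithmetic-geometric mean
inequality, but only the logarithm matters. -/
lemma det_featureCov_le {lam : ℝ} (hlam : 0 < lam) {X : ℕ → EuclideanSpace ℝ (Fin p)}
    (hX : ∀ s, 1 ≤ s → ‖X s‖ ≤ 1) (t : ℕ) :
    (featureCov lam X t).det ≤ (t + lam * p) ^ p := by
  have hpd := posDef_featureCov hlam X t
  have hH := hpd.isHermitian
  have hpos : ∀ i, 0 < hH.eigenvalues i := hH.posDef_iff_eigenvalues_pos.1 hpd
  have htr : (featureCov lam X t).trace ≤ t + lam * p := by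
    rw [featureCov, Matrix.trace_add, Matrix.trace_sum, Matrix.trace_smul, Matrix.trace_one]
    simp only [Matrix.trace_vecMulVec, Fintype.card_fin, smul_eq_mul]
    gcongr
    calc _ ≤ ∑ s ∈ Finset.Icc 1 t, (1 : ℝ) := by
          refine Finset.sum_le_sum fun s hs => ?_
          have h1 : (X s).ofLp ⬝ᵥ (X s).ofLp = ‖X s‖ ^ 2 := by
            rw [← real_inner_self_eq_norm_sq, EuclideanSpace.inner_eq_star_dotProduct, star_trivial]
          rw [h1]
          exact pow_le_one₀ (norm_nonneg _) (hX s (Finset.mem_Icc.1 hs).1)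
      _ = t := by simp
  have hev : ∀ i, hH.eigenvalues i ≤ t + lam * p := fun i => by
    refine le_trans ?_ htr
    rw [hH.trace_eq_sum_eigenvalues]
    simpa using Finset.single_le_sum (fun j _ => (hpos j).le) (Finset.mem_univ i)
  rw [hH.det_eq_prod_eigenvalues]
  calc ∏ i, ((hH.eigenvalues i : ℝ)) ≤ ∏ _i : Fin p, ((t : ℝ) + lam * p) :=
        Finset.prod_le_prod (fun i _ => (hpos i).le) fun i _ => hev i
    _ = _ := by simp

/-- The elliptical potential lemma with unit regularisation. -/
lemma exists_elliptical_potential {X : ℕ → EuclideanSpace ℝ (Fin p)}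
    (hX : ∀ s, 1 ≤ s → ‖X s‖ ≤ 1) :
    ∃ q : ℕ → ℝ, (∀ t, 0 ≤ q t) ∧
      (∀ t u, ⟪u, X (t + 1)⟫ ^ 2 ≤ q t * (∑ s ∈ Finset.Icc 1 t, ⟪u, X s⟫ ^ 2 + ‖u‖ ^ 2)) ∧
      ∀ T : ℕ, ∑ t ∈ Finset.range T, q t ≤ 2 * (p * Real.log (T + p)) := by
  set A : ℕ → Matrix (Fin p) (Fin p) ℝ := featureCov 1 X with hA
  have hpd : ∀ t, (A t).PosDef := posDef_featureCov one_pos X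
  set q : ℕ → ℝ := fun t => (X (t + 1)).ofLp ⬝ᵥ ((A t)⁻¹.mulVec (X (t + 1)).ofLp) with hq
  have hinner : ∀ u x : EuclideanSpace ℝ (Fin p), u.ofLp ⬝ᵥ x.ofLp = ⟪u, x⟫ := fun u x => by
    rw [EuclideanSpace.inner_eq_star_dotProduct, star_trivial, dotProduct_comm]
  have hq0 : ∀ t, 0 ≤ q t := fun t => by
    simpa using (hpd t).inv.posSemidef.dotProduct_mulVec_nonneg (X (t + 1)).ofLp
  have hcs : ∀ t u, ⟪u, X (t + 1)⟫ ^ 2 ≤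
      q t * (∑ s ∈ Finset.Icc 1 t, ⟪u, X s⟫ ^ 2 + ‖u‖ ^ 2) := fun t u => by
    have h := sq_dotProduct_le_of_posDef (hpd t) (X (t + 1)).ofLp u.ofLp
    rwa [hinner, dotProduct_featureCov_mulVec, one_mul] at h
  -- With `w = A⁻¹ x`, unit regularisation gives `‖w‖ ^ 2 ≤ q`, while `q = ⟪w, x⟫ ≤ ‖w‖`; hence `q ^
  -- 2 ≤ q`.
  have hq1 : ∀ t, q t ≤ 1 := fun t => by
    set w : EuclideanSpace ℝ (Fin p) := WithLp.toLp 2 ((A t)⁻¹.mulVec (X (t + 1)).ofLp) with hw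
    have h1 : ⟪w, X (t + 1)⟫ = q t := by rw [← hinner, dotProduct_comm]
    have h2 : w.ofLp ⬝ᵥ ((A t).mulVec w.ofLp) = q t := by
      rw [hw, Matrix.mulVec_mulVec, Matrix.mul_nonsing_inv _ (hpd t).det_pos.ne'.isUnit,
        Matrix.one_mulVec, dotProduct_comm]
    rw [dotProduct_featureCov_mulVec, one_mul] at h2
    have h3 : ‖w‖ ^ 2 ≤ q t := by
      have := Finset.sum_nonneg fun s (_ : s ∈ Finset.Icc 1 t) => sq_nonneg ⟪w, X s⟫
      linarith
    have h4 : q t ≤ ‖w‖ := by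
      rw [← h1]
      calc _ ≤ ‖w‖ * ‖X (t + 1)‖ := real_inner_le_norm _ _
        _ ≤ ‖w‖ * 1 := by gcongr; exact hX _ (by omega)
        _ = ‖w‖ := mul_one _
    nlinarith [hq0 t, norm_nonneg w]
  have hdet : ∀ T, (A T).det = ∏ t ∈ Finset.range T, (1 + q t) := fun T => by
    induction T with
    | zero => simp [hA, featureCov]
    | succ T ih => rw [Finset.prod_range_succ, ← ih]; exact det_featureCov_succ one_pos X T
  refine ⟨q, hq0, hcs, fun T => ?_⟩
  calc ∑ t ∈ Finset.range T, q t ≤ ∑ t ∈ Finset.range T, 2 * Real.log (1 + q t) := by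
        refine Finset.sum_le_sum fun t _ => ?_
        have h0 := hq0 t
        have h1 := hq1 t
        have h2 := Real.one_sub_inv_le_log_of_pos (show 0 < 1 + q t by linarith)
        have h3 : q t / 2 ≤ 1 - (1 + q t)⁻¹ := by
          have h4 : 1 - (1 + q t)⁻¹ = q t / (1 + q t) := by field_simp; ring
          rw [h4]
          gcongr
          linarith
        linarith
    _ = 2 * Real.log (A T).det := by
        rw [hdet, ← Finset.mul_sum, Real.log_prod fun t _ => by linarith [hq0 t]]
    _ ≤ 2 * (p * Real.log (T + p)) := by
        rw [← Real.log_pow]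
        gcongr
        · exact (hpd T).det_pos
        · simpa using det_featureCov_le one_pos hX T

end EllipticalPotential

/-! ### Regret with an additive price of delay. -/

section Regret

variable {p : ℕ}

/-- Optimism bounds the gap by the width of `S` in the direction of the played arm. The width is
measured in the matrix of all `t` past rounds: those seen by `S` contribute `Γ`, while the `d - 1`
unseen ones and the regulariser contribute at most `4 * B ^ 2` each. -/
lemma sq_gap_le_of_optimistic {B Γ q : ℝ} {d t : ℕ} (hd : 0 < d) (hdt : d ≤ t) (hB : 0 < B)
    {X : ℕ → EuclideanSpace ℝ (Fin p)} (hX : ∀ s, 1 ≤ s → ‖X s‖ ≤ 1) (hq : 0 ≤ q)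
    (hcs : ∀ u, ⟪u, X (t + 1)⟫ ^ 2 ≤ q * (∑ s ∈ Finset.Icc 1 t, ⟪u, X s⟫ ^ 2 + ‖u‖ ^ 2))
    {S : Set (EuclideanSpace ℝ (Fin p))} (hS : ∀ θ ∈ S, ‖θ‖ ≤ B)
    {θstar : EuclideanSpace ℝ (Fin p)} (hθ : θstar ∈ S)
    (hΓ : ∀ θ ∈ S, ∑ s ∈ Finset.Icc 1 (t + 1 - d), ⟪θ - θstar, X s⟫ ^ 2 ≤ Γ)
    {𝒳 : Set (EuclideanSpace ℝ (Fin p))} (hmax : IsMaxOn (ucb S) 𝒳 (X (t + 1)))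
    {x : EuclideanSpace ℝ (Fin p)} (hx : x ∈ 𝒳) (hgap : 0 ≤ ⟪x - X (t + 1), θstar⟫) :
    ⟪x - X (t + 1), θstar⟫ ^ 2 ≤ q * (Γ + 4 * B ^ 2 * d) := by
  have hdiff : ∀ θ ∈ S, ‖θ - θstar‖ ≤ 2 * B := fun θ h =>
    (norm_sub_le _ _).trans (by linarith [hS θ h, hS θstar hθ])
  have hbound : ∀ θ ∈ S, ∑ s ∈ Finset.Icc 1 t, ⟪θ - θstar, X s⟫ ^ 2 + ‖θ - θstar‖ ^ 2 ≤
      Γ + 4 * B ^ 2 * d := by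
    intro θ h
    have hn := hdiff θ h
    have hterm : ∀ s, 1 ≤ s → ⟪θ - θstar, X s⟫ ^ 2 ≤ 4 * B ^ 2 := fun s hs => by
      have h1 : |⟪θ - θstar, X s⟫| ≤ 2 * B :=
        calc _ ≤ ‖θ - θstar‖ * ‖X s‖ := abs_real_inner_le_norm _ _
          _ ≤ 2 * B * 1 := mul_le_mul hn (hX s hs) (norm_nonneg _) (by linarith)
          _ = 2 * B := mul_one _
      have := sq_le_sq' (abs_le.1 h1).1 (abs_le.1 h1).2
      linarith
    have hsplit : ∑ s ∈ Finset.Icc 1 t, ⟪θ - θstar, X s⟫ ^ 2 =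
        ∑ s ∈ Finset.Icc 1 (t + 1 - d), ⟪θ - θstar, X s⟫ ^ 2 +
          ∑ s ∈ Finset.Ioc (t + 1 - d) t, ⟪θ - θstar, X s⟫ ^ 2 := by
      rw [← Finset.sum_union]
      · congr 1
        ext s
        simp only [Finset.mem_union, Finset.mem_Icc, Finset.mem_Ioc]
        omega
      · refine Finset.disjoint_left.2 fun s => ?_
        simp only [Finset.mem_Icc, Finset.mem_Ioc]
        omega
    have hlast : ∑ s ∈ Finset.Ioc (t + 1 - d) t, ⟪θ - θstar, X s⟫ ^ 2 ≤ (d - 1) * (4 * B ^ 2) := by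
      calc _ ≤ ∑ s ∈ Finset.Ioc (t + 1 - d) t, 4 * B ^ 2 :=
            Finset.sum_le_sum fun s hs => hterm s (by have := (Finset.mem_Ioc.1 hs).1; omega)
        _ = _ := by
            rw [Finset.sum_const, Nat.card_Ioc, nsmul_eq_mul,
              show t - (t + 1 - d) = d - 1 by omega, Nat.cast_sub hd, Nat.cast_one]
    have hnorm : ‖θ - θstar‖ ^ 2 ≤ 4 * B ^ 2 := by
      nlinarith [norm_nonneg (θ - θstar)]
    rw [hsplit]
    linarith [hΓ θ h]
  set ρ := √(q * (Γ + 4 * B ^ 2 * d)) with hρ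
  have hpos : 0 ≤ q * (Γ + 4 * B ^ 2 * d) :=
    mul_nonneg hq (le_trans (by positivity) (hbound θstar hθ))
  have hbdd : BddAbove ((fun θ => ⟪x, θ⟫) '' S) := by
    refine ⟨‖x‖ * B, ?_⟩
    rintro _ ⟨θ, h, rfl⟩
    exact (real_inner_le_norm _ _).trans (by gcongr; exact hS θ h)
  have h1 : ⟪x, θstar⟫ ≤ ucb S x := le_csSup hbdd ⟨θstar, hθ, rfl⟩
  have h2 : ucb S x ≤ ucb S (X (t + 1)) := hmax hx
  have h3 : ucb S (X (t + 1)) ≤ ⟪X (t + 1), θstar⟫ + ρ := by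
    refine csSup_le ⟨_, ⟨θstar, hθ, rfl⟩⟩ ?_
    rintro _ ⟨θ, h, rfl⟩
    have h4 : ⟪θ - θstar, X (t + 1)⟫ ≤ ρ := by
      refine Real.le_sqrt_of_sq_le ((hcs _).trans ?_)
      exact mul_le_mul_of_nonneg_left (hbound θ h) hq
    rw [inner_sub_left, real_inner_comm, real_inner_comm (X (t + 1)) θstar] at h4
    simp only
    linarith
  have h5 : ⟪x - X (t + 1), θstar⟫ ≤ ρ := by
    rw [inner_sub_left]; linarith
  calc _ ≤ ρ ^ 2 := by gcongr
    _ = _ := Real.sq_sqrt hpos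

lemma regret_le_of_optimistic {Ω : Type*} {B Γ Δ : ℝ} {d T : ℕ} (hd : 0 < d) (hB : 0 < B)
    (hΔ : 0 < Δ) (hΓ0 : 0 ≤ Γ)
    {𝒳 : ℕ → Set (EuclideanSpace ℝ (Fin p))} {θstar : EuclideanSpace ℝ (Fin p)}
    {xstar : ℕ → EuclideanSpace ℝ (Fin p)} (hgap : HasGap 𝒳 θstar xstar T Δ)
    (h𝒳 : ∀ t, 1 ≤ t → 𝒳 t ⊆ Metric.closedBall 0 1)
    {X : ℕ → Ω → EuclideanSpace ℝ (Fin p)} {ω : Ω} (hX : ∀ t, 1 ≤ t → X t ω ∈ 𝒳 t)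
    {S : ℕ → Set (EuclideanSpace ℝ (Fin p))} (hS : ∀ t, ∀ θ ∈ S t, ‖θ‖ ≤ B) (hθB : ‖θstar‖ ≤ B)
    (hθ : ∀ t, d < t → t ≤ T → θstar ∈ S t)
    (hΓ : ∀ t, d < t → t ≤ T → ∀ θ ∈ S t,
      ∑ s ∈ Finset.Icc 1 (t - d), ⟪θ - θstar, X s ω⟫ ^ 2 ≤ Γ)
    (hmax : ∀ t, d < t → IsMaxOn (ucb (S t)) (𝒳 t) (X t ω)) :
    regret 𝒳 θstar X T ω ≤
      (4 * B ^ 2 * d + 2 * (p * Real.log (T + p)) * (Γ + 4 * B ^ 2 * d)) / Δ := by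
  have hXn : ∀ s, 1 ≤ s → ‖X s ω‖ ≤ 1 := fun s hs =>
    mem_closedBall_zero_iff.1 (h𝒳 s hs (hX s hs))
  obtain ⟨q, hq0, hcs, hqsum⟩ := exists_elliptical_potential hXn
  have hround : ∀ t ∈ Finset.range T,
      (⨆ x : 𝒳 (t + 1), (⟪(x : EuclideanSpace ℝ (Fin p)), θstar⟫ - ⟪X (t + 1) ω, θstar⟫)) ≤
        ((if t < d then 4 * B ^ 2 else 0) + q t * (Γ + 4 * B ^ 2 * d)) / Δ := by
    intro t ht
    have hmem : t + 1 ∈ Finset.Icc 1 T :=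
      Finset.mem_Icc.2 ⟨by omega, by have := Finset.mem_range.1 ht; omega⟩
    obtain ⟨h1, h2, h3⟩ := hgap (t + 1) hmem
    have hXm := hX (t + 1) (by omega)
    set g := ⟪xstar (t + 1) - X (t + 1) ω, θstar⟫ with hg
    have hg0 : 0 ≤ g := by
      rw [hg, inner_sub_left]
      have := h2 hXm
      simp only [Set.mem_ofPred_eq] at this
      linarith
    have : Nonempty (𝒳 (t + 1)) := ⟨⟨_, h1⟩⟩
    have hsup : (⨆ x : 𝒳 (t + 1), (⟪(x : EuclideanSpace ℝ (Fin p)), θstar⟫ -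
        ⟪X (t + 1) ω, θstar⟫)) ≤ g := by
      refine ciSup_le fun x => ?_
      rw [hg, inner_sub_left]
      have := h2 x.2
      simp only [Set.mem_ofPred_eq] at this
      linarith
    -- Either the optimal arm is played and `g = 0`, or `g ≥ Δ`.
    have hgsq : g ≤ g ^ 2 / Δ := by
      by_cases hx : X (t + 1) ω = xstar (t + 1)
      · rw [hg, hx, sub_self, inner_zero_left]; simp
      · rw [le_div_iff₀ hΔ]
        have := h3 _ hXm hx
        nlinarith
    refine hsup.trans (hgsq.trans ?_)
    gcongr
    have hqn : 0 ≤ q t * (Γ + 4 * B ^ 2 * d) := mul_nonneg (hq0 t) (by positivity)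
    split_ifs with htd
    · have h4 : g ≤ 2 * B := by
        have h5 : ‖xstar (t + 1)‖ ≤ 1 := mem_closedBall_zero_iff.1 (h𝒳 _ (by omega) h1)
        have h6 : ‖xstar (t + 1) - X (t + 1) ω‖ ≤ 2 :=
          (norm_sub_le _ _).trans (by linarith [hXn (t + 1) (by omega)])
        calc g ≤ ‖xstar (t + 1) - X (t + 1) ω‖ * ‖θstar‖ := real_inner_le_norm _ _
          _ ≤ 2 * B := by gcongr
      nlinarith
    · rw [zero_add]
      have htT := (Finset.mem_Icc.1 hmem).2
      exact sq_gap_le_of_optimistic (X := fun s => X s ω) hd (not_lt.1 htd) hB hXn (hq0 t)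
        (hcs t) (hS (t + 1)) (hθ (t + 1) (by omega) htT) (hΓ (t + 1) (by omega) htT)
        (hmax (t + 1) (by omega)) h1 hg0
  have hfirst : ∑ t ∈ Finset.range T, (if t < d then 4 * B ^ 2 else 0) ≤ 4 * B ^ 2 * d := by
    rw [← Finset.sum_filter, Finset.sum_const, nsmul_eq_mul, mul_comm]
    gcongr
    calc _ ≤ (Finset.range d).card := Finset.card_le_card fun t ht => by
          simpa using (Finset.mem_filter.1 ht).2
      _ = d := Finset.card_range d
  have hshift : ∀ f : ℕ → ℝ, ∑ t ∈ Finset.Icc 1 T, f t = ∑ t ∈ Finset.range T, f (t + 1) :=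
    fun f => by
      rw [Finset.range_eq_Ico, Finset.sum_Ico_add' f 0 T 1]
      rfl
  rw [regret, hshift]
  refine (Finset.sum_le_sum hround).trans ?_
  rw [← Finset.sum_div, Finset.sum_add_distrib, ← Finset.sum_mul]
  gcongr
  exact hqsum T

end Regret

end MixingBandit
end

noncomputable section

namespace MixingBandit

/-! ### Comparison of the bounds for large horizons. -/

section Asymptotics

lemma radius_mono {p : ℕ} {B lam δ φd : ℝ} (hB : 0 < B) (hφ : 0 ≤ φd) {d : ℕ} (hd : 0 < d)
    (hp : 1 ≤ p) : Monotone (radius p B lam δ φd d) := by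
  intro s t hst
  have hst' : (s : ℝ) ≤ t := Nat.cast_le.2 hst
  have hd' : (0 : ℝ) < d := Nat.cast_pos.2 hd
  have hp' : (0 : ℝ) < p := Nat.cast_pos.2 hp
  have hm : 0 < max ((d : ℝ) * p) (s + d) := lt_max_of_lt_left (by positivity)
  unfold radius
  gcongr

lemma radius_le {p : ℕ} {B δ φd : ℝ} (hB : 0 < B) {d : ℕ} (hd : 0 < d)
    (hp : 1 ≤ p) (t : ℕ) :
    radius p B (1 / B ^ 2) δ φd d t ≤
      d * p / 2 * Real.log ((B + 1) ^ 2 * Real.exp 1 * (t + 2)) + 2 + t * φd * (B + 1) +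
        d * Real.log (d / δ) := by
  have hd' : (1 : ℝ) ≤ d := Nat.one_le_cast.2 hd
  have hp' : (1 : ℝ) ≤ p := Nat.one_le_cast.2 hp
  have hdp : (1 : ℝ) ≤ d * p := by nlinarith
  have hm : 0 < max ((d : ℝ) * p) (t + d) := lt_max_of_lt_left (by positivity)
  have ht : (0 : ℝ) ≤ t := Nat.cast_nonneg t
  have h1 : max ((d : ℝ) * p) (t + d) / (d * p) ≤ t + 2 := by
    rw [div_le_iff₀ (by positivity)]
    refine max_le (by nlinarith) ?_
    nlinarith [mul_le_mul_of_nonneg_left hdp ht, mul_le_mul_of_nonneg_left hp' (zero_le_one.trans hd')]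
  have h2 : 2 * (1 / B ^ 2) * B ^ 2 = 2 := by field_simp
  unfold radius
  rw [h2, mul_div_assoc ((B + 1) ^ 2 * Real.exp 1)]
  gcongr

set_option maxHeartbeats 1000000 in
/-- Explicit form of the comparison of the regret bounds: `T` is large compared with all other
parameters, with `ρ = T ^ (1 / (1 + r))` and `Λ = log T`. -/
lemma slack_and_bound_of_large {p : ℕ} (hp : 1 ≤ p) {B C r δ : ℝ} (hB : 0 < B) (hC : 0 < C)
    (hr : 0 < r) (hδ : 0 < δ) {a D c₁ c₂ ρ Λ : ℝ} {T : ℕ} (ha : a = 1 / (1 + r))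
    (hD : D = C ^ (-r)) (hc₁ : c₁ = p + 4 + (B + 1) * D)
    (hc₂ : c₂ = 4 * B ^ 2 + 4 * p * (8 * c₁ + 4 * B ^ 2)) (hρdef : ρ = (T : ℝ) ^ a)
    (hΛ : Λ = Real.log T) (h1 : 2 * c₂ * Λ ^ 2 ≤ p * ρ) (h2 : 1 ≤ Λ) (h3 : (p : ℝ) + 1 ≤ T)
    (h4 : 3 * ((B + 1) ^ 2 * Real.exp 1) ≤ T) (h5 : 2 * C / δ ≤ T) (h6 : 1 ≤ C * ρ)
    (h7 : 2 * B * D + 2 / δ ≤ Real.log (C * ρ / δ)) (h8 : 1 ≤ Real.log (C * ρ / δ))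
    (h9 : Real.exp 1 ≤ B ^ 2 / (p * C) * (T : ℝ) ^ (1 - a)) {d : ℕ} (hd : d = ⌈C * ρ⌉₊) :
    0 < d ∧
      2 * B * T * (C * (d : ℝ) ^ (-r)) + 2 * d / δ ≤ d * Real.log (d / δ) ∧
      4 * B ^ 2 * d + 2 * (p * Real.log (T + p)) *
          (8 * radius p B (1 / B ^ 2) δ (C * (d : ℝ) ^ (-r)) d T + 4 * B ^ 2 * d) ≤
        C * p * (T : ℝ) ^ (2 / (1 + r)) *
          Real.log (1 + B ^ 2 * T / (p * C * ρ)) *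
          ((p : ℝ) / 2 * Real.log ((B + 1) ^ 2 * Real.exp 1 * T / p) +
            Real.log (C * ρ / δ)) := by
  have hp' : (1 : ℝ) ≤ p := Nat.one_le_cast.2 hp
  have ha0 : 0 < a := by rw [ha]; positivity
  have ha1 : a < 1 := by rw [ha, div_lt_one (by positivity)]; linarith
  have hD0 : 0 < D := hD ▸ Real.rpow_pos_of_pos hC _
  have hT2 : (2 : ℝ) ≤ T := by linarith
  have hTpos : (0 : ℝ) < T := by linarith
  have hρ0 : 0 < ρ := hρdef ▸ Real.rpow_pos_of_pos hTpos _
  have hρT : ρ ≤ T := by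
    calc ρ ≤ (T : ℝ) ^ (1 : ℝ) := hρdef ▸ Real.rpow_le_rpow_of_exponent_le (by linarith) ha1.le
      _ = T := Real.rpow_one _
  have hdl : C * ρ ≤ d := hd ▸ Nat.le_ceil _
  have hdu : (d : ℝ) ≤ 2 * (C * ρ) := by
    have := Nat.ceil_lt_add_one (zero_le_one.trans h6)
    rw [← hd] at this
    linarith
  have hd1 : (1 : ℝ) ≤ d := h6.trans hdl
  have hd0 : 0 < d := Nat.one_le_cast.1 hd1
  -- The choice of delay balances `T * ρ ^ (-r) = ρ`, so the accumulated bias is of order `d`.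
  have hφ : T * (C * (d : ℝ) ^ (-r)) ≤ D * d := by
    have e1 : (d : ℝ) ^ (-r) ≤ (C * ρ) ^ (-r) :=
      Real.rpow_le_rpow_of_nonpos (by positivity) hdl (by linarith)
    have e2 : (C * ρ) ^ (-r) = D * ρ ^ (-r) := by
      rw [hD, Real.mul_rpow hC.le hρ0.le]
    have e3 : (T : ℝ) * ρ ^ (-r) = ρ := by
      rw [hρdef, ← Real.rpow_mul hTpos.le]
      nth_rewrite 1 [← Real.rpow_one (T : ℝ)]
      rw [← Real.rpow_add hTpos]
      congr 1
      rw [ha]; field_simp; ring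
    calc T * (C * (d : ℝ) ^ (-r)) ≤ T * (C * (D * ρ ^ (-r))) := by rw [← e2]; gcongr
      _ = D * (C * (T * ρ ^ (-r))) := by ring
      _ = D * (C * ρ) := by rw [e3]
      _ ≤ D * d := by gcongr
  have hlogd : Real.log (C * ρ / δ) ≤ Real.log (d / δ) := by gcongr
  refine ⟨hd0, ?_, ?_⟩
  · calc 2 * B * T * (C * (d : ℝ) ^ (-r)) + 2 * d / δ
        = 2 * B * (T * (C * (d : ℝ) ^ (-r))) + 2 / δ * d := by ring
      _ ≤ 2 * B * (D * d) + 2 / δ * d := by gcongr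
      _ = d * (2 * B * D + 2 / δ) := by ring
      _ ≤ _ := by gcongr; exact h7.trans hlogd
  have hsq : ∀ y : ℝ, 0 < y → y ≤ (T : ℝ) ^ 2 → Real.log y ≤ 2 * Λ := fun y hy hyT => by
    have := Real.log_le_log hy hyT
    rwa [Real.log_pow, Nat.cast_ofNat, ← hΛ] at this
  have l1 : Real.log (T + p) ≤ 2 * Λ := hsq _ (by positivity) (by nlinarith)
  have l2 : Real.log ((B + 1) ^ 2 * Real.exp 1 * (T + 2)) ≤ 2 * Λ := by
    refine hsq _ (by positivity) ?_
    have : 0 < (B + 1) ^ 2 * Real.exp 1 := by positivity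
    nlinarith
  have l3 : Real.log (d / δ) ≤ 2 * Λ := by
    refine hsq _ (by positivity) ?_
    calc (d : ℝ) / δ ≤ 2 * (C * T) / δ := by gcongr; exact hdu.trans (by gcongr)
      _ = 2 * C / δ * T := by ring
      _ ≤ T * T := by gcongr
      _ = _ := (sq _).symm
  -- In `c₁`, the logarithmic term gives `p`, the regularisation and `log (d / δ)` give `2` each,
  -- and the bias gives `(B + 1) * D`.
  have hR : radius p B (1 / B ^ 2) δ (C * (d : ℝ) ^ (-r)) d T ≤ d * (c₁ * Λ) := by
    refine (radius_le hB hd0 hp T).trans ?_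
    have e1 : (d : ℝ) * p / 2 * Real.log ((B + 1) ^ 2 * Real.exp 1 * (T + 2)) ≤
        d * p / 2 * (2 * Λ) := by gcongr
    have e2 : (2 : ℝ) ≤ 2 * d * Λ := by linarith [one_le_mul_of_one_le_of_one_le hd1 h2]
    have e3 : T * (C * (d : ℝ) ^ (-r)) * (B + 1) ≤ (B + 1) * D * d * Λ := by
      calc _ ≤ D * d * (B + 1) := by gcongr
        _ = (B + 1) * D * d * 1 := by ring
        _ ≤ _ := by gcongr
    have e4 : (d : ℝ) * Real.log (d / δ) ≤ d * (2 * Λ) := by gcongr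
    rw [hc₁]
    linarith
  have hc₁0 : 0 < c₁ := by rw [hc₁]; positivity
  have hΛ2 : Λ ≤ Λ ^ 2 := le_self_pow₀ h2 two_ne_zero
  have hlhs : 4 * B ^ 2 * d + 2 * (p * Real.log (T + p)) *
      (8 * radius p B (1 / B ^ 2) δ (C * (d : ℝ) ^ (-r)) d T + 4 * B ^ 2 * d) ≤
        d * (c₂ * Λ ^ 2) := by
    have e0 : 8 * radius p B (1 / B ^ 2) δ (C * (d : ℝ) ^ (-r)) d T + 4 * B ^ 2 * d ≤
        d * ((8 * c₁ + 4 * B ^ 2) * Λ) := by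
      have : 4 * B ^ 2 * d * 1 ≤ 4 * B ^ 2 * d * Λ := by gcongr
      linarith
    have e1 : 0 ≤ Real.log ((T : ℝ) + p) := Real.log_nonneg (by linarith)
    calc _ ≤ 4 * B ^ 2 * d * Λ ^ 2 + 2 * (p * (2 * Λ)) * (d * ((8 * c₁ + 4 * B ^ 2) * Λ)) := by
          refine add_le_add ?_ (mul_le_mul_of_nonneg ?_ e0 ?_ ?_)
          · have : 4 * B ^ 2 * d * 1 ≤ 4 * B ^ 2 * d * Λ ^ 2 := by gcongr; linarith
            linarith
          · gcongr
          · positivity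
          · positivity
      _ = _ := by rw [hc₂]; ring
  refine hlhs.trans ?_
  have hT2a : (T : ℝ) ^ (2 / (1 + r)) = ρ ^ 2 := by
    rw [hρdef, ← Real.rpow_natCast, ← Real.rpow_mul hTpos.le, ha]
    congr 1
    push_cast; ring
  have hf1 : 1 ≤ Real.log (1 + B ^ 2 * T / (p * C * ρ)) := by
    have e1 : B ^ 2 * T / (p * C * ρ) = B ^ 2 / (p * C) * (T : ℝ) ^ (1 - a) := by
      rw [Real.rpow_sub hTpos, Real.rpow_one, ← hρdef]; field_simp
    rw [Real.le_log_iff_exp_le (by positivity), e1]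
    linarith
  have hf2 : 1 ≤ (p : ℝ) / 2 * Real.log ((B + 1) ^ 2 * Real.exp 1 * T / p) +
      Real.log (C * ρ / δ) := by
    have e1 : 0 ≤ Real.log ((B + 1) ^ 2 * Real.exp 1 * T / p) := by
      refine Real.log_nonneg ?_
      rw [le_div_iff₀ (by positivity), one_mul]
      have e2 : (1 : ℝ) ≤ (B + 1) ^ 2 := by nlinarith
      have e3 : (1 : ℝ) ≤ Real.exp 1 := Real.one_le_exp zero_le_one
      have e4 : (1 : ℝ) ≤ (B + 1) ^ 2 * Real.exp 1 := one_le_mul_of_one_le_of_one_le e2 e3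
      nlinarith
    have : 0 ≤ (p : ℝ) / 2 * Real.log ((B + 1) ^ 2 * Real.exp 1 * T / p) := by positivity
    linarith
  have hc₂0 : 0 < c₂ := by rw [hc₂]; positivity
  rw [hT2a]
  -- Here `h1` trades `log ^ 2` and all constants for one power of `ρ`; both logarithmic factors of
  -- the target are only used through being at least `1`.
  calc (d : ℝ) * (c₂ * Λ ^ 2) ≤ 2 * (C * ρ) * (c₂ * Λ ^ 2) := by gcongr
    _ = C * ρ * (2 * c₂ * Λ ^ 2) := by ring
    _ ≤ C * ρ * (p * ρ) := by gcongr
    _ = C * p * ρ ^ 2 * 1 * 1 := by ring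
    _ ≤ _ := by gcongr

open Filter in
/-- For large horizons the delay makes the confidence sets valid, and the regret bound with an
additive price of delay is dominated by the one with a multiplicative price. -/
lemma eventually_slack_and_bound {p : ℕ} (hp : 1 ≤ p) {B C r δ : ℝ} (hB : 0 < B) (hC : 0 < C)
    (hr : 0 < r) (hδ : 0 < δ) :
    ∀ᶠ T : ℕ in atTop, ∀ d : ℕ, d = ⌈C * (T : ℝ) ^ (1 / (1 + r))⌉₊ →
      0 < d ∧
      2 * B * T * (C * (d : ℝ) ^ (-r)) + 2 * d / δ ≤ d * Real.log (d / δ) ∧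
      4 * B ^ 2 * d + 2 * (p * Real.log (T + p)) *
          (8 * radius p B (1 / B ^ 2) δ (C * (d : ℝ) ^ (-r)) d T + 4 * B ^ 2 * d) ≤
        C * p * (T : ℝ) ^ (2 / (1 + r)) *
          Real.log (1 + B ^ 2 * T / (p * C * (T : ℝ) ^ (1 / (1 + r)))) *
          ((p : ℝ) / 2 * Real.log ((B + 1) ^ 2 * Real.exp 1 * T / p) +
            Real.log (C * (T : ℝ) ^ (1 / (1 + r)) / δ)) := by
  set a : ℝ := 1 / (1 + r) with ha
  have ha0 : 0 < a := by positivity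
  have ha1 : a < 1 := by rw [ha, div_lt_one (by positivity)]; linarith
  set D : ℝ := C ^ (-r) with hD
  have hD0 : 0 < D := Real.rpow_pos_of_pos hC _
  set c₁ : ℝ := p + 4 + (B + 1) * D with hc₁
  set c₂ : ℝ := 4 * B ^ 2 + 4 * p * (8 * c₁ + 4 * B ^ 2) with hc₂
  have hp' : (1 : ℝ) ≤ p := Nat.one_le_cast.2 hp
  have hcast : Tendsto (fun T : ℕ => (T : ℝ)) atTop atTop := tendsto_natCast_atTop_atTop
  have hρ : Tendsto (fun T : ℕ => (T : ℝ) ^ a) atTop atTop := (tendsto_rpow_atTop ha0).comp hcast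
  have hlog : Tendsto (fun T : ℕ => Real.log T) atTop atTop := Real.tendsto_log_atTop.comp hcast
  have hlogρ : Tendsto (fun T : ℕ => Real.log (C * (T : ℝ) ^ a / δ)) atTop atTop :=
    Real.tendsto_log_atTop.comp ((hρ.const_mul_atTop hC).atTop_div_const hδ)
  have hratio : Tendsto (fun T : ℕ => B ^ 2 / (p * C) * (T : ℝ) ^ (1 - a)) atTop atTop :=
    ((tendsto_rpow_atTop (sub_pos.2 ha1)).comp hcast).const_mul_atTop (by positivity)
  have hlogsq : ∀ᶠ T : ℕ in atTop, 2 * c₂ * Real.log T ^ 2 ≤ p * (T : ℝ) ^ a := by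
    have ho := ((isLittleO_log_rpow_rpow_atTop (s := a) 2 ha0).comp_tendsto hcast).const_mul_left
      (2 * c₂)
    filter_upwards [ho.bound zero_lt_one, hcast.eventually_ge_atTop 1] with T hT hT1
    simp only [Function.comp, Real.rpow_two, Real.norm_eq_abs, one_mul] at hT
    have hpos : 0 ≤ (T : ℝ) ^ a := by positivity
    rw [abs_of_nonneg hpos] at hT
    have := (le_abs_self _).trans hT
    nlinarith
  filter_upwards [hlogsq, hlog.eventually_ge_atTop 1, hcast.eventually_ge_atTop (p + 1),
    hcast.eventually_ge_atTop (3 * ((B + 1) ^ 2 * Real.exp 1)),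
    hcast.eventually_ge_atTop (2 * C / δ), (hρ.const_mul_atTop hC).eventually_ge_atTop 1,
    hlogρ.eventually_ge_atTop (2 * B * D + 2 / δ), hlogρ.eventually_ge_atTop 1,
    hratio.eventually_ge_atTop (Real.exp 1)] with T h1 h2 h3 h4 h5 h6 h7 h8 h9 d hd
  exact slack_and_bound_of_large hp hB hC hr hδ ha hD hc₁ hc₂ rfl rfl h1 h2 h3 h4 h5 h6 h7 h8 h9 hd

end Asymptotics

/-! ### Assembly. -/

lemma algebraicRate_toReal {C r : ℝ} (hC : 0 < C) (d : ℕ) :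
    (algebraicRate C r d).toReal = C * (d : ℝ) ^ (-r) := by
  rw [algebraicRate, ENNReal.toReal_mul, ENNReal.toReal_ofReal hC.le, ← ENNReal.toReal_rpow,
    ENNReal.toReal_natCast]

lemma algebraicRate_ne_top {C r : ℝ} {d : ℕ} (hd : 0 < d) : algebraicRate C r d ≠ ⊤ :=
  ENNReal.mul_ne_top ENNReal.ofReal_ne_top
    (ENNReal.rpow_ne_top_of_ne_zero (Nat.cast_ne_zero.2 hd.ne') (ENNReal.natCast_ne_top d))

/-- Both points are compared with the centre: `(a - b) ^ 2 ≤ 2 * a ^ 2 + 2 * b ^ 2`, and each sum of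
squares is at most twice the radius. -/
lemma sum_sq_le_of_mem_confidenceSet {p : ℕ} {B lam δ φd : ℝ} (hlam : 0 ≤ lam) {d t : ℕ}
    {X : ℕ → EuclideanSpace ℝ (Fin p)} {θhat θ θ' : EuclideanSpace ℝ (Fin p)}
    (hθ : θ ∈ confidenceSet B lam δ φd d X θhat t)
    (hθ' : θ' ∈ confidenceSet B lam δ φd d X θhat t) :
    ∑ s ∈ Finset.Icc 1 t, ⟪θ - θ', X s⟫ ^ 2 ≤ 8 * radius p B lam δ φd d t := by
  have h1 := hθ.2
  have h2 := hθ'.2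
  rw [weightedNorm_featureCov_sq hlam] at h1 h2
  have h3 : ∑ s ∈ Finset.Icc 1 t, ⟪θ - θ', X s⟫ ^ 2 ≤
      2 * ∑ s ∈ Finset.Icc 1 t, ⟪θ - θhat, X s⟫ ^ 2 +
        2 * ∑ s ∈ Finset.Icc 1 t, ⟪θ' - θhat, X s⟫ ^ 2 := by
    rw [Finset.mul_sum, Finset.mul_sum, ← Finset.sum_add_distrib]
    refine Finset.sum_le_sum fun s _ => ?_
    rw [show θ - θ' = (θ - θhat) - (θ' - θhat) by abel, inner_sub_left]
    nlinarith [sq_nonneg (⟪θ - θhat, X s⟫ + ⟪θ' - θhat, X s⟫)]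
  have h4 : 0 ≤ lam * ‖θ - θhat‖ ^ 2 := by positivity
  have h5 : 0 ≤ lam * ‖θ' - θhat‖ ^ 2 := by positivity
  unfold radius
  linarith

end MixingBandit
end

theorem corollary5 :
    ∃ K : ℝ, 0 < K ∧
      ∀ (p : ℕ), 1 ≤ p → ∀ (B C r δ : ℝ), 0 < B → 0 < C → 0 < r → 0 < δ → δ < 1 →
      ∃ T₀ : ℕ, ∀ T : ℕ, T₀ ≤ T →
      ∀ (Δ : ℝ), 0 < Δ →
      ∀ (Ω : Type*) [MeasurableSpace Ω] (μ : MeasureTheory.Measure Ω)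
        [MeasureTheory.IsProbabilityMeasure μ]
        (ε : ℕ → Ω → ℝ)
        (𝒳 : ℕ → Set (EuclideanSpace ℝ (Fin p)))
        (θstar : EuclideanSpace ℝ (Fin p))
        (xstar : ℕ → EuclideanSpace ℝ (Fin p))
        (X θhat : ℕ → Ω → EuclideanSpace ℝ (Fin p)),
        MixingBandit.IsMixingSubgaussian μ 1 (MixingBandit.algebraicRate C r) ε →
        (∀ t, 1 ≤ t → 𝒳 t ⊆ Metric.closedBall 0 1) →
        θstar ∈ Metric.closedBall (0 : EuclideanSpace ℝ (Fin p)) B →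
        MixingBandit.HasGap 𝒳 θstar xstar T Δ →
        MixingBandit.IsMixingLinUCB B (1 / B ^ 2) δ (MixingBandit.algebraicRate C r)
          ⌈C * (T : ℝ) ^ (1 / (1 + r))⌉₊ 𝒳 θstar ε X θhat →
        ENNReal.ofReal (1 - δ) ≤
          μ {ω | MixingBandit.regret 𝒳 θstar X T ω ≤
            K * (C * p / Δ * (T : ℝ) ^ (2 / (1 + r)) *
              Real.log (1 + B ^ 2 * T / (p * C * (T : ℝ) ^ (1 / (1 + r)))) *
              ((p : ℝ) / 2 * Real.log ((B + 1) ^ 2 * Real.exp 1 * T / p) +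
                Real.log (C * (T : ℝ) ^ (1 / (1 + r)) / δ)))} := by
  refine ⟨1, one_pos, fun p hp B C r δ hB hC hr hδ _ => ?_⟩
  obtain ⟨T₀, hT₀⟩ := Filter.eventually_atTop.1
    (MixingBandit.eventually_slack_and_bound hp hB hC hr hδ)
  -- The shift ensures `T ≥ 1`, so that a confidence set after round `T` is available below.
  refine ⟨T₀ + 1, fun T hT Δ hΔ Ω _ μ _ ε 𝒳 θstar xstar X θhat hε h𝒳 hθ hgap halg => ?_⟩
  obtain ⟨hd, hslack, hbound⟩ := hT₀ T (by omega) _ rfl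
  set d := ⌈C * (T : ℝ) ^ (1 / (1 + r))⌉₊ with hddef
  have hφ := MixingBandit.algebraicRate_toReal (r := r) hC d
  have hφ0 : 0 ≤ C * (d : ℝ) ^ (-r) := by positivity
  have hlam : 0 ≤ 1 / B ^ 2 := by positivity
  have hXn : ∀ t, 1 ≤ t → ∀ ω, ‖X t ω‖ ≤ 1 := fun t ht ω =>
    mem_closedBall_zero_iff.1 (h𝒳 t ht (halg.mem t ht ω))
  obtain ⟨S, hS, hSle⟩ := MixingBandit.exists_event_sum_le hε hd hp
    (MixingBandit.algebraicRate_ne_top hd) halg.measurable hXn hB hδ θstar T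
  have hbias : ∀ᵐ ω ∂μ, ∀ s, 1 ≤ s →
      |(μ[ε s | MixingBandit.noiseSigma ε (s - d)]) ω| ≤ C * (d : ℝ) ^ (-r) := by
    rw [MeasureTheory.ae_all_iff]
    intro s
    by_cases hs : 1 ≤ s
    · filter_upwards [hε.abs_condExp_le hs (MixingBandit.algebraicRate_ne_top hd)] with ω hω _
      rwa [← hφ]
    · exact MeasureTheory.ae_of_all _ fun ω h => absurd h hs
  refine hS.trans (MeasureTheory.measure_mono_ae ?_)
  filter_upwards [hbias] with ω hω hωS
  have hmem : ∀ t, 1 ≤ t → t ≤ T → θstar ∈ MixingBandit.confidenceSet B (1 / B ^ 2) δ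
      (C * (d : ℝ) ^ (-r)) d (fun s => X s ω) (θhat t ω) t := fun t ht htT =>
    MixingBandit.mem_confidenceSet_of_sum_le hB hlam hφ0 htT hslack (fun s hs => hXn s hs ω)
      (b := fun s => (μ[ε s | MixingBandit.noiseSigma ε (s - d)]) ω) hω hθ
      (halg.leastSquares t ht ω) (hSle ω hωS t htT)
  have hrad : ∀ t, t ≤ T → MixingBandit.radius p B (1 / B ^ 2) δ (C * (d : ℝ) ^ (-r)) d t ≤
      MixingBandit.radius p B (1 / B ^ 2) δ (C * (d : ℝ) ^ (-r)) d T := fun t ht =>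
    MixingBandit.radius_mono hB hφ0 hd hp ht
  -- The radius is nonnegative because the confidence set at `T` contains `θstar`.
  have hrad0 : 0 ≤ MixingBandit.radius p B (1 / B ^ 2) δ (C * (d : ℝ) ^ (-r)) d T := by
    have h1 := MixingBandit.sum_sq_le_of_mem_confidenceSet hlam (hmem T (by omega) le_rfl)
      (hmem T (by omega) le_rfl)
    have h2 := Finset.sum_nonneg fun s (_ : s ∈ Finset.Icc 1 T) => sq_nonneg
      (inner ℝ (θstar - θstar) (X s ω))
    linarith
  have hreg := MixingBandit.regret_le_of_optimistic (Γ := 8 * MixingBandit.radius p B (1 / B ^ 2) δ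
      (C * (d : ℝ) ^ (-r)) d T) (S := fun t => MixingBandit.confidenceSet B (1 / B ^ 2) δ
      (C * (d : ℝ) ^ (-r)) d (fun s => X s ω) (θhat (t - d) ω) (t - d)) hd hB hΔ (by linarith)
    hgap h𝒳 (fun t ht => halg.mem t ht ω) (fun t θ h => mem_closedBall_zero_iff.1 h.1)
    (mem_closedBall_zero_iff.1 hθ) (fun t hdt htT => hmem (t - d) (by omega) (by omega))
    (fun t hdt htT θ h => (MixingBandit.sum_sq_le_of_mem_confidenceSet hlam h
      (hmem (t - d) (by omega) (by omega))).trans (by linarith [hrad (t - d) (by omega)]))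
    (fun t hdt => by simpa only [hφ] using halg.optimistic t hdt ω)
  refine hreg.trans ?_
  rw [one_mul, div_le_iff₀ hΔ]
  refine hbound.trans (le_of_eq ?_)
  field_simp
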